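/- Let $V$ be a finite set of $n$ nodes and let $A=(A_{uv})_{u,v\in V}$ be the adjacency matrix of a (possibly weighted) graph on $V$, with nonnegative integer entries and with positive degrees $d_u:=\sum_{w\in V}A_{uw}>0$ for all $u\in V$. Let $T$ be the transition matrix, $T_{uw}:=A_{uw}/d_u$, and let $n_{uv}:=\sum_{w\in V}A_{uw}A_{vw}$. For every integer $q\ge 1$ let $R=R^{(q)}$ be a random $q\times n$ matrix whose entries are i.i.d. normal with mean $0$ and variance $1/q$. Let $P\in\{A,T\}$ and $X=X^{(q)}:=PR^\top$, write $X_{u*}\in\mathbb{R}^q$ for the row of $X$ of the node $u$, and let $\cos(x,y):=\frac{\langle x,y\rangle}{\|x\|\,\|y\|}$, with the Euclidean inner product and norm. Then the following hold. (a) Asymptotic result. For all $u,v\in V$ put $\sigma_{uv}:=1-\frac{n_{uv}^2}{n_{uu}n_{vv}}\in[0,1]$. As $q\to\infty$, $$\sqrt{q}\left(\cos(X_{u*},X_{v*})-\frac{n_{uv}}{\sqrt{n_{uu}n_{vv}}}\right)\xrightarrow{\ d\ }\mathcal N\left(0,\sigma_{uv}^2\right),$$ where $\mathcal N(0,0)$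 is the point mass at $0$; and if $\sigma_{uv}\neq 0$, then $$\frac{\sqrt q}{\sigma_{uv}}\left(\cos(X_{u*},X_{v*})-\frac{n_{uv}}{\sqrt{n_{uu}n_{vv}}}\right)\xrightarrow{\ d\ }\mathcal N(0,1).$$ That is, $\cos(X_{u*},X_{v*})$ is asymptotically normal with mean $\frac{n_{uv}}{\sqrt{n_{uu}n_{vv}}}$ and variance $\frac1q\left(1-\frac{n_{uv}^2}{n_{uu}n_{vv}}\right)^2$. (b) Finite-sample result. Let $\varepsilon\in(0,0.05]$ and $\delta\in(0,1)$. If $q\ge1$ is an integer with $$q\ \ge\ \frac{2\ln\left[\frac{2n(n-1)\left(1+\frac{\varepsilon^2}{4}\right)}{\delta}\right]}{\ln\left[1+\frac{\varepsilon^2}{2(1+\varepsilon\sqrt2)}\right]}$$ (for $n\le 1$ the logarithm in the numerator is of $0$ and the condition is void), then with probability at least $1-\delta$ the inequality $$\left|\cos(X_{u*},X_{v*})-\frac{n_{uv}}{\sqrt{n_{uu}n_{vv}}}\right|\ \le\ \varepsilon\left(1-\frac{n_{uv}^2}{n_{uu}n_{vv}}\right)$$ holds simultaneously for all $u,v\in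 V$. -/

import Mathlib

open MeasureTheory ProbabilityTheory Filter
open scoped NNReal Matrix

namespace RPCosine

/-! A finite graph on the node set `V` is given by its adjacency matrix `A : Matrix V V ℕ`
(entries in `{0, 1}` for a simple graph, arbitrary nonnegative integers for a weighted one). -/

/-- The degree `d_u = ∑_w A_{uw}` of a node. -/
def deg {V : Type*} [Fintype V] (A : Matrix V V ℕ) (u : V) : ℕ := ∑ w, A u w

/-- The 2-hop connectivity `n_{uv} = A_{u*} A_{v*}ᵀ`. -/
def conn {V : Type*} [Fintype V] (A : Matrix V V ℕ) (u v : V) : ℕ := A u ⬝ᵥ A v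

/-- The adjacency matrix as a real matrix. -/
def adjMat {V : Type*} (A : Matrix V V ℕ) : Matrix V V ℝ := A.map (fun k => (k : ℝ))

/-- The transition matrix, with rows `T_{u*} = A_{u*} / d_u`. -/
noncomputable def transMat {V : Type*} [Fintype V] (A : Matrix V V ℕ) : Matrix V V ℝ :=
  Matrix.of fun u w => (A u w : ℝ) / (deg A u : ℝ)

/-- Cosine similarity `(x, y) / (‖x‖ ‖y‖)` with Euclidean inner product and Euclidean norms. -/
noncomputable def cosSim {ι : Type*} [Fintype ι] (x y : ι → ℝ) : ℝ :=
  (x ⬝ᵥ y) / (‖WithLp.toLp 2 x‖ * ‖WithLp.toLp 2 y‖)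

/-- `n_{uv} / √(n_{uu} n_{vv})`. -/
noncomputable def connCos {V : Type*} [Fintype V] (A : Matrix V V ℕ) (u v : V) : ℝ :=
  (conn A u v : ℝ) / Real.sqrt ((conn A u u : ℝ) * (conn A v v : ℝ))

/-- `1 - n_{uv}² / (n_{uu} n_{vv})`. -/
noncomputable def connDefect {V : Type*} [Fintype V] (A : Matrix V V ℕ) (u v : V) : ℝ :=
  1 - (conn A u v : ℝ) ^ 2 / ((conn A u u : ℝ) * (conn A v v : ℝ))

/-- A random `q × V` matrix whose entries are i.i.d. normal with mean `0` and variance `1 / q`. -/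
structure IsGaussianProjection {V Ω : Type*} [MeasurableSpace Ω] (q : ℕ)
    (R : Ω → Matrix (Fin q) V ℝ) (μ : Measure Ω) : Prop where
  law : ∀ (i : Fin q) (j : V), HasLaw (fun ω => R ω i j) (gaussianReal 0 ((q : ℝ≥0)⁻¹)) μ
  indep : iIndepFun (fun (p : Fin q × V) (ω : Ω) => R ω p.1 p.2) μ

/-- `Y_q` is asymptotically `𝒩(m, σ² / q)` as `q → ∞` (with `σ ≥ 0`):
`(Y_q - m) / σ * √q` converges in distribution to `𝒩(0, 1)` if `σ ≠ 0`, and in every case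
`√q * (Y_q - m)` converges in distribution to `𝒩(0, σ²)`.  For `σ > 0` the two clauses are
equivalent; for `σ = 0` the limit `𝒩(0, 0)` in the second one is the point mass at `0`. -/
def IsAsympNormal {Ω : ℕ → Type*} [∀ q, MeasurableSpace (Ω q)] (μ : ∀ q, Measure (Ω q))
    [∀ q, IsProbabilityMeasure (μ q)] (Y : ∀ q, Ω q → ℝ) (m σ : ℝ) : Prop :=
  (σ ≠ 0 → TendstoInDistribution (fun (q : ℕ) (ω : Ω q) => (Y q ω - m) / σ * Real.sqrt (q : ℝ)) atTop
    (id : ℝ → ℝ) μ (gaussianReal 0 1)) ∧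
  TendstoInDistribution (fun (q : ℕ) (ω : Ω q) => Real.sqrt (q : ℝ) * (Y q ω - m)) atTop
    (id : ℝ → ℝ) μ (gaussianReal 0 (Real.toNNReal (σ ^ 2)))

end RPCosine

namespace RPCosine

/-! ### Gaussian integrals of exponentials of quadratic forms -/

/-! Each row of `P` is a positive multiple of the unit vector `unitRow A u`, for the adjacency and
for the transition matrix alike, and the cosine ignores positive scalings. The unit vectors of `u`
and `v` have inner product `ρ = connCos A u v`, so the cosine of the projected rows is the sample
cosine `pairCos` of `q` independent pairs with law `binormal ρ` (`exists_pairs`). Everything else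
concerns such a sample, with `a`, `d` the sums of squares of the two coordinates and `b` the sum of
products.

Finite-sample bound: the event `b > c √(ad)` is not quadratic. Comparing `√(ad)` with `(a + d) / 2`
turns it into events "a sum of quadratic forms is nonnegative", each of which has an exact Chernoff
bound, since the exponential moment of a Gaussian quadratic form is the inverse square root of a
determinant. For `c ≤ 0` the inequality of means suffices; for `c > 0` the events where `a` and `d`
differ too much must be split off (`measure_lt_pairCos_le`). A union bound over unordered pairs of
distinct nodes concludes. If `ρ = 1`, in particular on the diagonal, the cosine is almost surely
`1`; `ρ = -1` cannot occur since the entries are nonnegative.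

Asymptotics: `√(ad) = (a + d) / 2 - (√a - √d)² / 2` splits `√q (cos - ρ)` exactly into a normalized
sum of the centred variables `xy - ρ (x² + y²) / 2`, of variance `(1 - ρ²)²`, and a remainder
governed by `(a - d)² / q^(3/2)` (`sqrt_mul_cos_sub_eq`). The central limit theorem, Chebyshev's
inequality, the law of large numbers for `a / q`, `d / q`, and Slutsky's theorem give the limit,
including the degenerate case. -/

lemma lintegral_exp_quadratic_gaussianReal {α : ℝ} (hα : 0 < 1 - 2 * α) (β : ℝ) :
    ∫⁻ x, ENNReal.ofReal (Real.exp (α * x ^ 2 + β * x)) ∂(gaussianReal 0 1) =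
      ENNReal.ofReal ((Real.sqrt (1 - 2 * α))⁻¹ * Real.exp (β ^ 2 / (2 * (1 - 2 * α)))) := by
  set t := 1 - 2 * α with ht
  set v : ℝ≥0 := ⟨t⁻¹, by positivity⟩ with hv
  have hv0 : v ≠ 0 := by
    intro h
    have := congrArg NNReal.toReal h
    exact (inv_pos.2 hα).ne' this
  have hvt : (v : ℝ) = t⁻¹ := rfl
  rw [gaussianReal_of_var_ne_zero _ one_ne_zero,
    lintegral_withDensity_eq_lintegral_mul _ (measurable_gaussianPDF 0 1) (by fun_prop)]
  -- Completing the square: the integrand is a constant times the normal density of mean `β / t` and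
  -- variance `1 / t`.
  have key : ∀ x, (gaussianPDF 0 1 * fun x => ENNReal.ofReal (Real.exp (α * x ^ 2 + β * x))) x =
      ENNReal.ofReal ((Real.sqrt t)⁻¹ * Real.exp (β ^ 2 / (2 * t))) *
        gaussianPDF (β / t) v x := by
    intro x
    simp only [Pi.mul_apply, gaussianPDF]
    rw [← ENNReal.ofReal_mul (gaussianPDFReal_nonneg _ _ _), ← ENNReal.ofReal_mul (by positivity)]
    congr 1
    simp only [gaussianPDFReal, hvt, NNReal.coe_one, mul_one, sub_zero]
    have h1 : Real.sqrt (2 * Real.pi * t⁻¹) = Real.sqrt (2 * Real.pi) * (Real.sqrt t)⁻¹ := by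
      rw [Real.sqrt_mul (by positivity), Real.sqrt_inv]
    have h2 : Real.sqrt t ≠ 0 := (Real.sqrt_pos.2 hα).ne'
    have h3 : Real.sqrt (2 * Real.pi) ≠ 0 := by positivity
    rw [h1]
    have h4 : -x ^ 2 / 2 + (α * x ^ 2 + β * x) =
        β ^ 2 / (2 * t) + -(x - β / t) ^ 2 / (2 * t⁻¹) := by
      have : α = (1 - t) / 2 := by rw [ht]; ring
      rw [this]
      field_simp
      ring
    rw [mul_assoc, ← Real.exp_add, h4, Real.exp_add]
    field_simp
  simp_rw [key]
  rw [lintegral_const_mul _ (measurable_gaussianPDF _ _), lintegral_gaussianPDF_eq_one _ hv0,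
    mul_one]

/-- The centred bivariate normal law with unit variances and correlation `ρ`. -/
noncomputable def binormal (ρ : ℝ) : Measure (ℝ × ℝ) :=
  ((gaussianReal 0 1).prod (gaussianReal 0 1)).map
    fun p => (p.1, ρ * p.1 + Real.sqrt (1 - ρ ^ 2) * p.2)

lemma measurable_correlate (ρ : ℝ) :
    Measurable fun p : ℝ × ℝ => (p.1, ρ * p.1 + Real.sqrt (1 - ρ ^ 2) * p.2) := by fun_prop

instance (ρ : ℝ) : IsProbabilityMeasure (binormal ρ) :=
  Measure.isProbabilityMeasure_map (measurable_correlate ρ).aemeasurable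

/-- The quadratic form `α x² + β x y + γ y²`. -/
def quadForm (α β γ : ℝ) (z : ℝ × ℝ) : ℝ := α * z.1 ^ 2 + β * (z.1 * z.2) + γ * z.2 ^ 2

@[fun_prop]
lemma measurable_quadForm (α β γ : ℝ) : Measurable (quadForm α β γ) := by
  unfold quadForm
  fun_prop

/-- The determinant governing the Laplace transform of `quadForm α β γ` under `binormal ρ`. -/
def quadDet (ρ α β γ : ℝ) : ℝ :=
  1 - 2 * (α + γ + ρ * β) + (1 - ρ ^ 2) * (4 * α * γ - β ^ 2)

/-- `quadDet` is `det (1 - 2 Σ M)`, with `Σ` the covariance matrix and `M` the matrix of the form.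
Integrating out the second independent coordinate needs `hγ`; the remaining one-dimensional integral
then has parameter `quadDet / t`, which `hD` makes positive. -/
lemma lintegral_exp_quadForm_binormal {ρ α β γ : ℝ} (hρ : ρ ^ 2 ≤ 1)
    (hγ : 0 < 1 - 2 * (γ * (1 - ρ ^ 2))) (hD : 0 < quadDet ρ α β γ) :
    ∫⁻ z, ENNReal.ofReal (Real.exp (quadForm α β γ z)) ∂(binormal ρ) =
      ENNReal.ofReal (Real.sqrt (quadDet ρ α β γ))⁻¹ := by
  have hs : Real.sqrt (1 - ρ ^ 2) ^ 2 = 1 - ρ ^ 2 := Real.sq_sqrt (by linarith)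
  set s := Real.sqrt (1 - ρ ^ 2)
  rw [← hs] at hγ
  set t := 1 - 2 * (γ * s ^ 2) with ht
  set A := α + β * ρ + γ * ρ ^ 2 + (β * s + 2 * γ * ρ * s) ^ 2 / (2 * t) with hA
  have hA' : 1 - 2 * A = quadDet ρ α β γ / t := by
    rw [eq_div_iff hγ.ne', hA, quadDet, ← hs, sub_mul, mul_add, add_mul]
    have : 2 * ((β * s + 2 * γ * ρ * s) ^ 2 / (2 * t)) * t = (β * s + 2 * γ * ρ * s) ^ 2 := by
      field_simp
    rw [this, ht]
    have hρs : s ^ 2 = 1 - ρ ^ 2 := hs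
    linear_combination (-2 * γ) * hρs
  rw [binormal, lintegral_map (by fun_prop) (measurable_correlate ρ),
    lintegral_prod _ (by fun_prop)]
  have inner : ∀ x : ℝ, ∫⁻ y, ENNReal.ofReal (Real.exp (quadForm α β γ (x, ρ * x + s * y)))
      ∂(gaussianReal 0 1) =
      ENNReal.ofReal (Real.sqrt t)⁻¹ * ENNReal.ofReal (Real.exp (A * x ^ 2 + 0 * x)) := by
    intro x
    have : ∀ y, ENNReal.ofReal (Real.exp (quadForm α β γ (x, ρ * x + s * y))) =
        ENNReal.ofReal (Real.exp ((α + β * ρ + γ * ρ ^ 2) * x ^ 2)) *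
          ENNReal.ofReal (Real.exp ((γ * s ^ 2) * y ^ 2 + ((β * s + 2 * γ * ρ * s) * x) * y)) := by
      intro y
      rw [← ENNReal.ofReal_mul (by positivity), ← Real.exp_add]
      congr 2
      simp only [quadForm]
      ring
    simp_rw [this]
    rw [lintegral_const_mul _ (by fun_prop), lintegral_exp_quadratic_gaussianReal hγ,
      ← ENNReal.ofReal_mul (by positivity), ← ENNReal.ofReal_mul (by positivity),
      mul_left_comm, ← Real.exp_add]
    congr 3
    rw [hA]
    ring
  rw [show Real.sqrt (1 - ρ ^ 2) = s from rfl]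
  simp only [inner]
  rw [lintegral_const_mul _ (by fun_prop),
    lintegral_exp_quadratic_gaussianReal (by rw [hA']; positivity), hA',
    ← ENNReal.ofReal_mul (by positivity)]
  congr 1
  rw [Real.sqrt_div hD.le]
  have : Real.sqrt t ≠ 0 := (Real.sqrt_pos.2 hγ).ne'
  simp
  field_simp

/-! ### Chernoff bound for sums of quadratic forms of normal pairs -/

section Chernoff

variable {Ω : Type*} [MeasurableSpace Ω] {μ : Measure Ω} {q : ℕ} {Z : Fin q → Ω → ℝ × ℝ} {ρ : ℝ}

/-- Markov's inequality for the exponential of the sum, whose expectation factors by independence.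
The Chernoff parameter is absorbed into the coefficients of the form. -/
lemma measure_quadForm_nonneg_le (hρ : ρ ^ 2 ≤ 1) (hZ : ∀ i, HasLaw (Z i) (binormal ρ) μ)
    (hind : iIndepFun Z μ) {α β γ : ℝ}
    (hγ : 0 < 1 - 2 * (γ * (1 - ρ ^ 2))) (hD : 0 < quadDet ρ α β γ) :
    μ {ω | 0 ≤ ∑ i, quadForm α β γ (Z i ω)} ≤
      ENNReal.ofReal ((Real.sqrt (quadDet ρ α β γ))⁻¹ ^ q) := by
  set ν := Measure.pi fun _ : Fin q => binormal ρ
  have hlaw : HasLaw (fun ω i => Z i ω) ν μ := hind.hasLaw_pi hZ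
  have hset : MeasurableSet {z : Fin q → ℝ × ℝ | 0 ≤ ∑ i, quadForm α β γ (z i)} :=
    measurableSet_le measurable_const (by fun_prop)
  have e1 : μ {ω | 0 ≤ ∑ i, quadForm α β γ (Z i ω)} =
      ν {z | 0 ≤ ∑ i, quadForm α β γ (z i)} := hlaw.measure_eq hset
  rw [e1]
  calc ν {z | 0 ≤ ∑ i, quadForm α β γ (z i)}
      ≤ ν {z | 1 ≤ ∏ i, ENNReal.ofReal (Real.exp (quadForm α β γ (z i)))} := by
        refine measure_mono fun z hz => ?_
        simp only [Set.mem_ofPred_eq] at hz ⊢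
        rw [← ENNReal.ofReal_prod_of_nonneg (fun i _ => by positivity), ← Real.exp_sum]
        simpa using hz
    _ ≤ ∫⁻ z, ∏ i, ENNReal.ofReal (Real.exp (quadForm α β γ (z i))) ∂ν := by
        have := mul_meas_ge_le_lintegral₀ (μ := ν) (f := fun z : Fin q → ℝ × ℝ =>
          ∏ i, ENNReal.ofReal (Real.exp (quadForm α β γ (z i))))
          (Measurable.aemeasurable (by fun_prop)) 1
        simpa using this
    _ = ENNReal.ofReal ((Real.sqrt (quadDet ρ α β γ))⁻¹ ^ q) := by
        have h1 : iIndepFun (fun (i : Fin q) (z : Fin q → ℝ × ℝ) =>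
            ENNReal.ofReal (Real.exp (quadForm α β γ (z i)))) ν :=
          iIndepFun_pi (X := fun _ z => ENNReal.ofReal (Real.exp (quadForm α β γ z)))
            fun i => by fun_prop
        rw [lintegral_prod_eq_prod_lintegral_of_indepFun Finset.univ _ h1 (fun i => by fun_prop)]
        have h2 : ∀ i : Fin q, ∫⁻ z, ENNReal.ofReal (Real.exp (quadForm α β γ (z i))) ∂ν =
            ENNReal.ofReal (Real.sqrt (quadDet ρ α β γ))⁻¹ := by
          intro i
          rw [← lintegral_exp_quadForm_binormal hρ hγ hD]
          exact (measurePreserving_eval (fun _ : Fin q => binormal ρ) i).lintegral_comp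
            (f := fun z => ENNReal.ofReal (Real.exp (quadForm α β γ z))) (by fun_prop)
        simp only [h2, Finset.prod_const, Finset.card_univ, Fintype.card_fin]
        rw [ENNReal.ofReal_pow (by positivity)]

end Chernoff

/-! ### Tail bounds for the cosine of a sample of correlated normal pairs -/

/-- Cosine similarity of the two coordinate vectors of a finite family of pairs. -/
noncomputable def pairCos {ι : Type*} [Fintype ι] (z : ι → ℝ × ℝ) : ℝ :=
  cosSim (fun i => (z i).1) fun i => (z i).2

lemma pairCos_eq {ι : Type*} [Fintype ι] (z : ι → ℝ × ℝ) :
    pairCos z = (∑ i, (z i).1 * (z i).2) /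
      (Real.sqrt (∑ i, (z i).1 ^ 2) * Real.sqrt (∑ i, (z i).2 ^ 2)) := by
  simp [pairCos, cosSim, dotProduct, EuclideanSpace.norm_eq]

/-- Clearing the denominator loses strictness: if one of the vectors vanishes, Cauchy–Schwarz kills
the numerator as well and both sides are `0`. -/
lemma mul_sqrt_le_of_lt_pairCos {ι : Type*} [Fintype ι] {z : ι → ℝ × ℝ} {e c : ℝ}
    (h : c < e * pairCos z) :
    c * (Real.sqrt (∑ i, (z i).1 ^ 2) * Real.sqrt (∑ i, (z i).2 ^ 2)) ≤
      e * ∑ i, (z i).1 * (z i).2 := by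
  have hcs := Finset.sum_mul_sq_le_sq_mul_sq Finset.univ (fun i => (z i).1) fun i => (z i).2
  rw [pairCos_eq] at h
  have ha : 0 ≤ ∑ i, (z i).1 ^ 2 := Finset.sum_nonneg fun i _ => sq_nonneg _
  rw [← Real.sqrt_mul ha] at h ⊢
  set P := (∑ i, (z i).1 ^ 2) * ∑ i, (z i).2 ^ 2
  rcases (Real.sqrt_nonneg P).eq_or_lt with h0 | h0
  · have hP : P ≤ 0 := Real.sqrt_eq_zero'.1 h0.symm
    have : ∑ i, (z i).1 * (z i).2 = 0 := by nlinarith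
    rw [← h0, this]
    simp
  · rw [← mul_div_assoc, lt_div_iff₀ h0] at h
    exact h.le

/-- The rate of the finite-sample bound. -/
noncomputable def tailRate (ε : ℝ) : ℝ := ε ^ 2 / (2 * (1 + ε * Real.sqrt 2))

lemma tailRate_pos {ε : ℝ} (hε : 0 < ε) : 0 < tailRate ε := by unfold tailRate; positivity

/-- Uses `√2 ≥ 1.4` and `1 / (1 + x) ≤ 1 - x + x²` at `x = 1.4 ε`. -/
lemma tailRate_le {ε : ℝ} (hε : 0 < ε) : 2 * tailRate ε ≤ ε ^ 2 * (1 - 1.4 * ε + 1.96 * ε ^ 2) := by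
  have h2 : (1.4 : ℝ) ≤ Real.sqrt 2 := Real.le_sqrt_of_sq_le (by norm_num)
  have h3 : 2 * tailRate ε = ε ^ 2 * (1 / (1 + ε * Real.sqrt 2)) := by
    unfold tailRate
    field_simp
  rw [h3]
  gcongr
  rw [div_le_iff₀ (by positivity)]
  have h4 : 1 + 1.4 * ε ≤ 1 + ε * Real.sqrt 2 := by nlinarith
  have h5 : 0 ≤ 1 - 1.4 * ε + 1.96 * ε ^ 2 := by nlinarith [sq_nonneg (1.4 * ε - 1 / 2)]
  nlinarith [mul_le_mul_of_nonneg_left h4 h5, pow_pos hε 3]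

lemma one_add_tailRate_sq_le {ε : ℝ} (hε : 0 < ε) :
    (1 + tailRate ε) ^ 2 ≤ 1 + ε ^ 2 * (1 - 1.4 * ε + 2.21 * ε ^ 2) := by
  have h1 := tailRate_le hε
  have h0 := tailRate_pos hε
  have h2 : tailRate ε ≤ ε ^ 2 / 2 := by
    unfold tailRate
    gcongr
    nlinarith [mul_pos hε (Real.sqrt_pos.2 two_pos)]
  nlinarith [mul_self_le_mul_self h0.le h2]

/-- With `m = (a + d) / 2`, `ad = m² - ((a - d) / 2)² ≥ m² (1 - y²)`. The factor `0.6` exceeds the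
Taylor coefficient `1/2` of `√(1 - y²)` enough to be valid up to `y² = 1/2`. -/
lemma le_sqrt_mul_sqrt {a d y : ℝ} (ha : 0 ≤ a) (hy : y ^ 2 ≤ 1 / 2)
    (h1 : a - d ≤ y * (a + d)) (h2 : d - a ≤ y * (a + d)) :
    (1 - 0.6 * y ^ 2) * ((a + d) / 2) ≤ Real.sqrt a * Real.sqrt d := by
  rw [← Real.sqrt_mul ha]
  refine Real.le_sqrt_of_sq_le ?_
  have h3 : (a - d) ^ 2 ≤ (y * (a + d)) ^ 2 := sq_le_sq.2 (abs_le_abs h1 (by linarith))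
  have h4 : (1 - 0.6 * y ^ 2) ^ 2 ≤ 1 - y ^ 2 := by nlinarith [sq_nonneg y]
  nlinarith [mul_le_mul_of_nonneg_right h4 (sq_nonneg (a + d))]

/-- Numerical core of the case `c > 0`. Here `c'` is the threshold lowered to pay for replacing
`√(ad)` by `(a + d) / 2`, and `y = ε √S` gives the norm-gap events about the same rate `1 + ε²` as
the main event. Both determinants must reach `(1 + tailRate ε)²`, which is also `1 + ε²` to leading
order. -/
lemma tail_rate_bounds {σ S ε c y c' : ℝ} (hSσ : S = 1 - σ ^ 2) (hs : 0 < S) (hε : 0 < ε)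
    (hε' : ε ≤ 0.05) (hc : c = σ + ε * S) (hc0 : 0 < c) (hy : y = ε * Real.sqrt S)
    (hc' : c' = c * (1 - 0.6 * y ^ 2)) :
    σ < c' ∧ c' ^ 2 < 1 ∧ 0 < y ∧ y < 1 ∧ y ^ 2 ≤ 1 / 2 ∧
      (1 + tailRate ε) ^ 2 ≤ 1 + (c' - σ) ^ 2 / (S * (1 - c' ^ 2)) ∧
      (1 + tailRate ε) ^ 2 ≤ 1 + y ^ 2 / (S * (1 - y ^ 2)) := by
  have hs1 : S ≤ 1 := by linarith [sq_nonneg σ]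
  have hσ2 : σ < 1 := (abs_lt.1 ((sq_lt_one_iff_abs_lt_one σ).1 (by linarith))).2
  have hεS : 0 < ε * S := by positivity
  have hc1 : c ≤ 1 := by
    have : ε * (1 + σ) ≤ 1 := by nlinarith
    have h2 : 1 - c = (1 - σ) * (1 - ε * (1 + σ)) := by rw [hc, hSσ]; ring
    nlinarith [mul_nonneg (sub_nonneg.2 hσ2.le) (sub_nonneg.2 this)]
  have hy2 : y ^ 2 = ε ^ 2 * S := by rw [hy, mul_pow, Real.sq_sqrt hs.le]
  have hy0 : 0 < y := by rw [hy]; positivity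
  have hyε : y ^ 2 ≤ ε ^ 2 := by nlinarith [sq_nonneg ε]
  have hε2 : ε ^ 2 ≤ 0.0025 := by nlinarith
  have hy1 : y < 1 := by
    rw [← abs_of_pos hy0, ← sq_lt_one_iff_abs_lt_one]
    linarith
  have hgap : ε * S * (1 - 0.6 * ε) ≤ c' - σ := by
    have h1 : c' - σ = ε * S * (1 - 0.6 * ε * c) := by rw [hc', hy2, hc]; ring
    have h2 : 0.6 * ε * c ≤ 0.6 * ε * 1 := by gcongr
    rw [h1]
    exact mul_le_mul_of_nonneg_left (by linarith) hεS.le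
  have hgap0 : 0 < c' - σ := lt_of_lt_of_le (mul_pos hεS (by linarith)) hgap
  have hc'0 : 0 < c' := hc' ▸ mul_pos hc0 (by linarith)
  have hc'1 : c' < 1 := by
    have := mul_pos hc0 (pow_pos hy0 2)
    rw [hc']
    linarith
  have hc'2 : c' ^ 2 < 1 := by
    rw [sq_lt_one_iff_abs_lt_one, abs_of_pos hc'0]
    exact hc'1
  have hk1 : 0 < 1 - c' ^ 2 := by linarith
  -- For `σ ≥ 0`, `c' ≥ σ` gives `1 - c'² ≤ S`. For `σ < 0`, positivity of `c` forces `-σ ≤ ε`, so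
  -- `S` is at least `1 - ε²`.
  have hk : (1 - ε ^ 2) * (1 - c' ^ 2) ≤ S := by
    rcases le_or_gt 0 σ with h | h
    · have h1 : σ ^ 2 ≤ c' ^ 2 := by
        have : σ ≤ c' := by linarith
        gcongr
      have h2 := mul_nonneg (sq_nonneg ε) hk1.le
      linarith
    · have h1 : ε * S ≤ ε * 1 := by gcongr
      have h2 : (-σ) ^ 2 ≤ ε ^ 2 := by
        have h3 : -σ ≤ ε := by linarith
        have h4 : 0 ≤ -σ := by linarith
        gcongr
      have h3 : 0 ≤ (1 - ε ^ 2) * c' ^ 2 := mul_nonneg (by linarith) (sq_nonneg _)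
      linarith
  have hE : (1 + tailRate ε) ^ 2 ≤ 1 + ε ^ 2 * ((1 - 0.6 * ε) ^ 2 * (1 - ε ^ 2)) := by
    refine (one_add_tailRate_sq_le hε).trans ?_
    gcongr
    -- The room is the difference between the linear coefficients `1.4` (from `√2`) and `1.2` (from
    -- the lowered threshold); it beats the quadratic terms for `ε ≤ 0.05`.
    have h1 : 0 ≤ ε * (0.2 - 2.85 * ε) := mul_nonneg hε.le (by linarith)
    have h2 : 0 ≤ ε ^ 3 * (1.2 - 0.36 * ε) := mul_nonneg (pow_pos hε 3).le (by linarith)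
    linear_combination h1 + h2
  have hD1 : (1 + tailRate ε) ^ 2 ≤ 1 + (c' - σ) ^ 2 / (S * (1 - c' ^ 2)) := by
    refine hE.trans ?_
    gcongr 1 + ?_
    rw [le_div_iff₀ (by positivity)]
    calc ε ^ 2 * ((1 - 0.6 * ε) ^ 2 * (1 - ε ^ 2)) * (S * (1 - c' ^ 2))
        = ε ^ 2 * (1 - 0.6 * ε) ^ 2 * S * ((1 - ε ^ 2) * (1 - c' ^ 2)) := by ring
      _ ≤ ε ^ 2 * (1 - 0.6 * ε) ^ 2 * S * S := by gcongr
      _ = (ε * S * (1 - 0.6 * ε)) ^ 2 := by ring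
      _ ≤ (c' - σ) ^ 2 := by
        have : 0 ≤ ε * S * (1 - 0.6 * ε) := mul_nonneg hεS.le (by linarith)
        gcongr
  have hD2 : (1 + tailRate ε) ^ 2 ≤ 1 + y ^ 2 / (S * (1 - y ^ 2)) := by
    have h0 : 0 < 1 - y ^ 2 := by nlinarith
    refine hE.trans ?_
    gcongr 1 + ?_
    rw [le_div_iff₀ (by positivity), hy2]
    have h1 : (1 - 0.6 * ε) ^ 2 * (1 - ε ^ 2) ≤ 1 := by
      have : (1 - 0.6 * ε) ^ 2 ≤ 1 := by nlinarith
      nlinarith [sq_nonneg (1 - 0.6 * ε)]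
    have h2 : S * (1 - ε ^ 2 * S) ≤ S * 1 := by
      gcongr
      linarith [sq_nonneg y]
    rw [mul_one] at h2
    calc ε ^ 2 * ((1 - 0.6 * ε) ^ 2 * (1 - ε ^ 2)) * (S * (1 - ε ^ 2 * S))
        ≤ ε ^ 2 * 1 * S := by
          have : 0 ≤ S * (1 - ε ^ 2 * S) := by rw [← hy2]; positivity
          gcongr
      _ = ε ^ 2 * S := by ring
  exact ⟨by linarith, hc'2, hy0, hy1, by linarith, hD1, hD2⟩

section Tail

variable {Ω : Type*} [MeasurableSpace Ω] {μ : Measure Ω} {q : ℕ} {Z : Fin q → Ω → ℝ × ℝ} {ρ : ℝ}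

lemma inv_sqrt_pow_le {D E : ℝ} (hD : 0 < D) (h : D ≤ E) (q : ℕ) :
    ENNReal.ofReal ((Real.sqrt E)⁻¹ ^ q) ≤ ENNReal.ofReal ((Real.sqrt D)⁻¹ ^ q) := by
  have := Real.sqrt_pos.2 hD
  gcongr

lemma measure_cross_le (hρ : ρ ^ 2 < 1) (hZ : ∀ i, HasLaw (Z i) (binormal ρ) μ)
    (hind : iIndepFun Z μ) {e c : ℝ} (he : e ^ 2 = 1) (hc : c ^ 2 < 1) (hρc : e * ρ < c) :
    μ {ω | c * (∑ i, (Z i ω).1 ^ 2 + ∑ i, (Z i ω).2 ^ 2) ≤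
        2 * (e * ∑ i, (Z i ω).1 * (Z i ω).2)} ≤
      ENNReal.ofReal
        ((Real.sqrt (1 + (c - e * ρ) ^ 2 / ((1 - ρ ^ 2) * (1 - c ^ 2))))⁻¹ ^ q) := by
  have hs : 0 < 1 - ρ ^ 2 := by linarith
  have hk : 0 < 1 - c ^ 2 := by linarith
  -- The optimal Chernoff parameter: it maximizes `1 + 4 θ (c - e ρ) - 4 θ² (1 - ρ²) (1 - c²)`, the
  -- determinant of the form `θ (2 e x y - c (x² + y²))`.
  set θ := (c - e * ρ) / (2 * (1 - ρ ^ 2) * (1 - c ^ 2)) with hθ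
  have hθ0 : 0 < θ := div_pos (by linarith) (by positivity)
  have hθk : 2 * θ * (1 - ρ ^ 2) * (1 - c ^ 2) = c - e * ρ := by
    rw [hθ]
    field_simp
  have hdet : quadDet ρ (-(θ * c)) (2 * θ * e) (-(θ * c)) =
      1 + (c - e * ρ) ^ 2 / ((1 - ρ ^ 2) * (1 - c ^ 2)) := by
    have h1 : (c - e * ρ) ^ 2 / ((1 - ρ ^ 2) * (1 - c ^ 2)) = 2 * θ * (c - e * ρ) := by
      rw [hθ]
      field_simp
    rw [h1, quadDet]
    linear_combination (-2 * θ) * hθk - 4 * θ ^ 2 * (1 - ρ ^ 2) * he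
  have hγ : 0 < 1 - 2 * (-(θ * c) * (1 - ρ ^ 2)) := by
    have h2 : (1 - 2 * (-(θ * c) * (1 - ρ ^ 2))) * (1 - c ^ 2) = 1 - c * (e * ρ) := by
      linear_combination c * hθk
    have h3 : c * (e * ρ) < 1 := by
      nlinarith [sq_nonneg (c - e * ρ), mul_pow e ρ 2]
    by_contra! h4
    nlinarith
  have := measure_quadForm_nonneg_le hρ.le hZ hind hγ (by rw [hdet]; positivity)
  rw [hdet] at this
  refine le_trans (measure_mono fun ω hω => ?_) this
  simp only [Set.mem_ofPred_eq] at hω ⊢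
  simp only [quadForm, Finset.sum_add_distrib, ← Finset.mul_sum]
  nlinarith [mul_le_mul_of_nonneg_left hω hθ0.le]

lemma measure_norm_gap_le (hρ : ρ ^ 2 < 1) (hZ : ∀ i, HasLaw (Z i) (binormal ρ) μ)
    (hind : iIndepFun Z μ) {e y : ℝ} (he : e ^ 2 = 1) (hy : 0 < y) (hy1 : y < 1) :
    μ {ω | y * (∑ i, (Z i ω).1 ^ 2 + ∑ i, (Z i ω).2 ^ 2) ≤
        e * (∑ i, (Z i ω).1 ^ 2 - ∑ i, (Z i ω).2 ^ 2)} ≤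
      ENNReal.ofReal ((Real.sqrt (1 + y ^ 2 / ((1 - ρ ^ 2) * (1 - y ^ 2))))⁻¹ ^ q) := by
  have hs : 0 < 1 - ρ ^ 2 := by linarith
  have hk : 0 < 1 - y ^ 2 := by nlinarith
  -- Again the maximizer of the determinant, now for the form `θ (e (x² - y²) - y (x² + y²))` in
  -- which the factor `y` is the parameter.
  set θ := y / (2 * (1 - ρ ^ 2) * (1 - y ^ 2)) with hθ
  have hθ0 : 0 < θ := by positivity
  have hθk : 2 * θ * (1 - ρ ^ 2) * (1 - y ^ 2) = y := by
    rw [hθ]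
    field_simp
  have hdet : quadDet ρ (θ * (e - y)) 0 (θ * (-e - y)) =
      1 + y ^ 2 / ((1 - ρ ^ 2) * (1 - y ^ 2)) := by
    have h1 : y ^ 2 / ((1 - ρ ^ 2) * (1 - y ^ 2)) = 2 * θ * y := by
      rw [hθ]
      field_simp
    rw [h1, quadDet]
    linear_combination (-2 * θ) * hθk - 4 * θ ^ 2 * (1 - ρ ^ 2) * he
  have hγ : 0 < 1 - 2 * (θ * (-e - y) * (1 - ρ ^ 2)) := by
    have h2 : (1 - 2 * (θ * (-e - y) * (1 - ρ ^ 2))) * (1 - y ^ 2) = 1 + e * y := by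
      linear_combination (e + y) * hθk
    have h3 : 0 < 1 + e * y := by
      rcases eq_or_eq_neg_of_sq_eq_sq e 1 (by linarith) with h | h <;> rw [h] <;> linarith
    by_contra! h4
    nlinarith
  have := measure_quadForm_nonneg_le hρ.le hZ hind hγ (by rw [hdet]; positivity)
  rw [hdet] at this
  refine le_trans (measure_mono fun ω hω => ?_) this
  simp only [Set.mem_ofPred_eq] at hω ⊢
  simp only [quadForm, Finset.sum_add_distrib, ← Finset.mul_sum]
  nlinarith [mul_le_mul_of_nonneg_left hω hθ0.le]

lemma measure_lt_pairCos_le [IsProbabilityMeasure μ] (hρ : ρ ^ 2 < 1)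
    (hZ : ∀ i, HasLaw (Z i) (binormal ρ) μ) (hind : iIndepFun Z μ) {e ε : ℝ} (he : e ^ 2 = 1)
    (hε : 0 < ε) (hε' : ε ≤ 0.05) :
    μ {ω | e * ρ + ε * (1 - ρ ^ 2) < e * pairCos fun i => Z i ω} ≤
      ENNReal.ofReal (2 * (Real.sqrt (1 + tailRate ε))⁻¹ ^ q) := by
  have hr := tailRate_pos hε
  have hs : 0 < 1 - ρ ^ 2 := by linarith
  have hρ' : (e * ρ) ^ 2 = ρ ^ 2 := by rw [mul_pow, he, one_mul]
  have hs1 : 1 - ρ ^ 2 ≤ 1 := by nlinarith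
  set σ := e * ρ with hσ
  set S := 1 - ρ ^ 2 with hS
  have hSσ : S = 1 - σ ^ 2 := by rw [hρ']
  have hσ1 : -1 < σ := by nlinarith
  have hσ2 : σ < 1 := by nlinarith
  set c := σ + ε * S with hc
  set x := (Real.sqrt (1 + tailRate ε))⁻¹ ^ q with hx
  have hx0 : 0 < x := by positivity
  have hεS : 0 < ε * S := by positivity
  -- For `c ≤ 0`, `c √(ad) ≥ c (a + d) / 2`, so one quadratic event covers the tail, with bound `x`.
  -- For `c > 0`, three events of probability at most `x²` are needed.
  rcases le_or_gt c 0 with hc0 | hc0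
  · have hσ0 : σ < 0 := by linarith
    have hk : 1 - c ^ 2 = S * (1 - 2 * σ * ε - ε ^ 2 * S) := by rw [hc, hSσ]; ring
    have hk1 : 0 < 1 - c ^ 2 := by nlinarith
    have hk2 : 1 - c ^ 2 ≤ S * (1 + 2 * ε) := by
      rw [hk]
      gcongr
      nlinarith [mul_pos hε hεS]
    have h := measure_cross_le hρ hZ hind he (c := c) (by linarith) (by linarith)
    have hD : 1 + tailRate ε ≤ 1 + (c - e * ρ) ^ 2 / ((1 - ρ ^ 2) * (1 - c ^ 2)) := by
      have h1 : (c - e * ρ) ^ 2 = ε ^ 2 * S * S := by rw [hc, ← hσ]; ring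
      rw [h1, ← hS, tailRate]
      have h2 : ε ^ 2 * S * S / (S * (1 - c ^ 2)) = ε ^ 2 * S / (1 - c ^ 2) := by field_simp
      rw [h2]
      gcongr 1 + ?_
      rw [div_le_div_iff₀ (by positivity) hk1]
      have h3 : (1.4 : ℝ) ≤ Real.sqrt 2 := Real.le_sqrt_of_sq_le (by norm_num)
      have h4 : 1 + 2 * ε ≤ 2 * (1 + ε * Real.sqrt 2) := by nlinarith
      calc ε ^ 2 * (1 - c ^ 2) ≤ ε ^ 2 * (S * (2 * (1 + ε * Real.sqrt 2))) := by
            gcongr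
            exact hk2.trans (by gcongr)
        _ = _ := by ring
    refine le_trans (measure_mono fun ω hω => ?_) (h.trans
      ((inv_sqrt_pow_le (by positivity) hD q).trans (ENNReal.ofReal_le_ofReal (by linarith))))
    have h5 := mul_sqrt_le_of_lt_pairCos hω
    simp only [Set.mem_ofPred_eq]
    have h6 : 0 ≤ ∑ i, (Z i ω).1 ^ 2 := Finset.sum_nonneg fun i _ => sq_nonneg _
    have h7 : 0 ≤ ∑ i, (Z i ω).2 ^ 2 := Finset.sum_nonneg fun i _ => sq_nonneg _
    nlinarith [Real.sq_sqrt h6, Real.sq_sqrt h7, mul_nonneg (neg_nonneg.2 hc0)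
      (sq_nonneg (Real.sqrt (∑ i, (Z i ω).1 ^ 2) - Real.sqrt (∑ i, (Z i ω).2 ^ 2)))]
  · set y := ε * Real.sqrt S with hy
    set c' := c * (1 - 0.6 * y ^ 2) with hc'
    obtain ⟨hgap, hc'2, hy0, hy1, hy2, hD1, hD2⟩ :=
      tail_rate_bounds hSσ hs hε hε' hc hc0 hy hc'
    have hD0 : 0 < (1 + tailRate ε) ^ 2 := by positivity
    have hxx : (Real.sqrt ((1 + tailRate ε) ^ 2))⁻¹ ^ q = x ^ 2 := by
      rw [Real.sqrt_sq (by positivity), hx, ← pow_mul, mul_comm q 2, pow_mul, inv_pow (Real.sqrt _),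
        Real.sq_sqrt (by positivity)]
    have b1 := (measure_cross_le hρ hZ hind he hc'2 hgap).trans
      (inv_sqrt_pow_le hD0 hD1 q)
    have b2 := (measure_norm_gap_le hρ hZ hind (e := 1) (by norm_num) hy0 hy1).trans
      (inv_sqrt_pow_le hD0 hD2 q)
    have b3 := (measure_norm_gap_le hρ hZ hind (e := -1) (by norm_num) hy0 hy1).trans
      (inv_sqrt_pow_le hD0 hD2 q)
    rw [hxx] at b1 b2 b3
    -- The bound `2 x` is trivial for `x ≥ 1/2`; otherwise `3 x² ≤ 2 x`.
    rcases le_or_gt (1 / 2) x with hx2 | hx2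
    · refine prob_le_one.trans ?_
      rw [← ENNReal.ofReal_one]
      exact ENNReal.ofReal_le_ofReal (by linarith)
    refine (measure_mono ?_).trans ((measure_union_le _ _).trans
      ((add_le_add ((measure_union_le _ _).trans (add_le_add b1 b2)) b3).trans ?_))
    · intro ω hω
      have h5 := mul_sqrt_le_of_lt_pairCos hω
      by_contra! hcon
      simp only [Set.mem_union, Set.mem_ofPred_eq, not_or, not_le] at hcon
      obtain ⟨⟨n1, n2⟩, n3⟩ := hcon
      have h6 : 0 ≤ ∑ i, (Z i ω).1 ^ 2 := Finset.sum_nonneg fun i _ => sq_nonneg _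
      have h7 : 0 ≤ ∑ i, (Z i ω).2 ^ 2 := Finset.sum_nonneg fun i _ => sq_nonneg _
      have h8 := le_sqrt_mul_sqrt h6 (y := y) hy2 (by linarith) (by linarith)
      have h9 := mul_le_mul_of_nonneg_left h8 hc0.le
      rw [hc'] at n1
      linarith
    · rw [← ENNReal.ofReal_add (by positivity) (by positivity),
        ← ENNReal.ofReal_add (by positivity) (by positivity)]
      exact ENNReal.ofReal_le_ofReal (by nlinarith)

lemma measure_pairCos_deviation_le [IsProbabilityMeasure μ] (hρ : ρ ^ 2 < 1)
    (hZ : ∀ i, HasLaw (Z i) (binormal ρ) μ) (hind : iIndepFun Z μ) {ε : ℝ}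
    (hε : 0 < ε) (hε' : ε ≤ 0.05) :
    μ {ω | ε * (1 - ρ ^ 2) < |pairCos (fun i => Z i ω) - ρ|} ≤
      ENNReal.ofReal (4 * (Real.sqrt (1 + tailRate ε))⁻¹ ^ q) := by
  have b1 := measure_lt_pairCos_le hρ hZ hind (e := 1) (by norm_num) hε hε'
  have b2 := measure_lt_pairCos_le hρ hZ hind (e := -1) (by norm_num) hε hε'
  have hr := tailRate_pos hε
  refine (measure_mono ?_).trans ((measure_union_le _ _).trans ((add_le_add b1 b2).trans ?_))
  · intro ω hω
    simp only [Set.mem_ofPred_eq] at hω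
    rcases lt_abs.1 hω with h | h
    · left
      simp only [Set.mem_ofPred_eq]
      linarith
    · right
      simp only [Set.mem_ofPred_eq]
      linarith
  · rw [← ENNReal.ofReal_add (by positivity) (by positivity)]
    exact ENNReal.ofReal_le_ofReal (by linarith)

end Tail

/-! ### Linear images of independent standard normal variables -/

section Gaussian

variable {V Ω : Type*} [Fintype V] [MeasurableSpace Ω] {μ : Measure Ω}

lemma hasLaw_dotProduct_gaussianReal {g : V → Ω → ℝ} (hg : ∀ j, HasLaw (g j) (gaussianReal 0 1) μ)
    (hind : iIndepFun g μ) (c : V → ℝ) :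
    HasLaw (fun ω => c ⬝ᵥ fun j => g j ω) (gaussianReal 0 (c ⬝ᵥ c).toNNReal) μ := by
  have hm : ∀ j, AEMeasurable (fun ω => c j * g j ω) μ :=
    fun j => (hg j).aemeasurable.const_mul _
  have hindc : iIndepFun (fun j ω => c j * g j ω) μ :=
    hind.comp (fun j t => c j * t) fun j => by fun_prop
  have := hind.isProbabilityMeasure
  have hmeas : AEMeasurable (fun ω => c ⬝ᵥ fun j => g j ω) μ := by
    simp only [dotProduct]
    exact Finset.aemeasurable_fun_sum _ fun j _ => hm j
  refine ⟨hmeas, ?_⟩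
  have : IsProbabilityMeasure (μ.map fun ω => c ⬝ᵥ fun j => g j ω) :=
    Measure.isProbabilityMeasure_map hmeas
  refine Measure.ext_of_charFun (funext fun t => ?_)
  simp only [dotProduct]
  rw [hindc.charFun_map_fun_sum_eq_prod hm, Finset.prod_apply, charFun_gaussianReal]
  have : ∀ j, charFun (μ.map fun ω => c j * g j ω) t = Complex.exp (-(c j * c j * t ^ 2 / 2)) := by
    intro j
    rw [(gaussianReal_const_mul (hg j) (c j)).map_eq, charFun_gaussianReal]
    congr 1
    simp [sq]
  simp only [this]
  rw [← Complex.exp_sum, Real.coe_toNNReal _ (Finset.sum_nonneg fun j _ => mul_self_nonneg _)]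
  congr 1
  simp [Finset.sum_div, Finset.sum_mul]

lemma hasLaw_add_mul_gaussianReal_prod (a b : ℝ) :
    HasLaw (fun p : ℝ × ℝ => a * p.1 + b * p.2) (gaussianReal 0 (a ^ 2 + b ^ 2).toNNReal)
      ((gaussianReal 0 1).prod (gaussianReal 0 1)) := by
  have h1 : HasLaw (fun p : ℝ × ℝ => p.1) (gaussianReal 0 1)
      ((gaussianReal 0 1).prod (gaussianReal 0 1)) := measurePreserving_fst.hasLaw
  have h2 : HasLaw (fun p : ℝ × ℝ => p.2) (gaussianReal 0 1)
      ((gaussianReal 0 1).prod (gaussianReal 0 1)) := measurePreserving_snd.hasLaw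
  have hi := indepFun_prod (μ := gaussianReal 0 1) (ν := gaussianReal 0 1)
    (X := fun x : ℝ => a * x) (Y := fun x : ℝ => b * x) (by fun_prop) (by fun_prop)
  refine ⟨by fun_prop, ?_⟩
  have := gaussianReal_add_gaussianReal_of_indepFun hi (gaussianReal_const_mul h1 a).map_eq
    (gaussianReal_const_mul h2 b).map_eq
  rw [show (fun p : ℝ × ℝ => a * p.1 + b * p.2) = (fun p => a * p.1) + fun p => b * p.2 from rfl,
    this]
  congr 1
  · simp
  · ext
    rw [Real.coe_toNNReal _ (by positivity)]
    simp

/-- Cramér–Wold: a law on the plane is determined by its linear functionals, and `a z₁ + b z₂` is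
centred normal with variance `a² + 2 a b ρ + b²` on both sides. -/
lemma hasLaw_binormal {g : V → Ω → ℝ} (hg : ∀ j, HasLaw (g j) (gaussianReal 0 1) μ)
    (hind : iIndepFun g μ) {x y : V → ℝ} {ρ : ℝ} (hρ : ρ ^ 2 ≤ 1) (hx : x ⬝ᵥ x = 1)
    (hy : y ⬝ᵥ y = 1) (hxy : x ⬝ᵥ y = ρ) :
    HasLaw (fun ω => (x ⬝ᵥ fun j => g j ω, y ⬝ᵥ fun j => g j ω)) (binormal ρ) μ := by
  have := hind.isProbabilityMeasure
  have hmx := (hasLaw_dotProduct_gaussianReal hg hind x).aemeasurable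
  have hmy := (hasLaw_dotProduct_gaussianReal hg hind y).aemeasurable
  refine ⟨hmx.prodMk hmy, ?_⟩
  have : IsProbabilityMeasure
      (μ.map fun ω => (x ⬝ᵥ fun j => g j ω, y ⬝ᵥ fun j => g j ω)) :=
    Measure.isProbabilityMeasure_map (hmx.prodMk hmy)
  refine Measure.ext_of_charFunDual (funext fun L => ?_)
  rw [charFunDual_eq_charFun_map_one, charFunDual_eq_charFun_map_one]
  congr 1
  set a := L (1, 0)
  set b := L (0, 1)
  have hL : ∀ p : ℝ × ℝ, L p = a * p.1 + b * p.2 := by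
    intro p
    have : p = p.1 • ((1 : ℝ), (0 : ℝ)) + p.2 • ((0 : ℝ), (1 : ℝ)) := by ext <;> simp
    conv_lhs => rw [this]
    rw [map_add, map_smul, map_smul, smul_eq_mul, smul_eq_mul]
    ring
  have hs : Real.sqrt (1 - ρ ^ 2) ^ 2 = 1 - ρ ^ 2 := Real.sq_sqrt (by linarith)
  rw [AEMeasurable.map_map_of_aemeasurable (by fun_prop) (hmx.prodMk hmy), binormal,
    Measure.map_map (by fun_prop) (measurable_correlate ρ)]
  have e1 : (L ∘ fun ω => (x ⬝ᵥ fun j => g j ω, y ⬝ᵥ fun j => g j ω)) =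
      fun ω => (a • x + b • y) ⬝ᵥ fun j => g j ω := by
    ext ω
    simp [hL, add_dotProduct, smul_dotProduct]
  have e2 : (L ∘ fun p : ℝ × ℝ => (p.1, ρ * p.1 + Real.sqrt (1 - ρ ^ 2) * p.2)) =
      fun p => (a + b * ρ) * p.1 + (b * Real.sqrt (1 - ρ ^ 2)) * p.2 := by
    ext p
    simp only [Function.comp, hL]
    ring
  rw [e1, e2, (hasLaw_dotProduct_gaussianReal hg hind _).map_eq,
    (hasLaw_add_mul_gaussianReal_prod _ _).map_eq]
  congr 2
  simp only [add_dotProduct, dotProduct_add, smul_dotProduct, dotProduct_smul, hx, hy, hxy,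
    dotProduct_comm y x, smul_eq_mul]
  linear_combination (-b ^ 2) * hs

/-- Currying carries the product measure on `ι × V` to the product over `ι` of the row laws. -/
lemma iIndepFun_rows {ι : Type*} [Fintype ι] {g : ι × V → Ω → ℝ}
    (hg : ∀ p, HasLaw (g p) (gaussianReal 0 1) μ) (hind : iIndepFun g μ) :
    iIndepFun (fun (i : ι) (ω : Ω) (j : V) => g (i, j) ω) μ := by
  have := hind.isProbabilityMeasure
  have hlaw := hind.hasLaw_pi hg
  have hrow : ∀ i : ι, HasLaw (fun (ω : Ω) (j : V) => g (i, j) ω)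
      (Measure.pi fun _ : V => gaussianReal 0 1) μ := fun i =>
    (hind.precomp (g := fun j : V => (i, j)) fun _ _ h => (Prod.mk.inj h).2).hasLaw_pi
      fun j => hg (i, j)
  rw [iIndepFun_iff_hasLaw_pi_pi hrow]
  refine ⟨aemeasurable_pi_lambda _ fun i => (hrow i).aemeasurable, ?_⟩
  have e : (fun (ω : Ω) (i : ι) (j : V) => g (i, j) ω) =
      MeasurableEquiv.curry ι V ℝ ∘ fun ω p => g p ω := rfl
  rw [e, ← AEMeasurable.map_map_of_aemeasurable (by fun_prop) hlaw.aemeasurable, hlaw.map_eq,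
    ← Measure.infinitePi_eq_pi, Measure.infinitePi_map_curry (fun _ _ => gaussianReal 0 1)]
  simp only [Measure.infinitePi_eq_pi]

end Gaussian

/-! ### Reduction of the projected rows to normal pairs -/

section Projection

variable {V Ω : Type*} [MeasurableSpace Ω] {μ : Measure Ω} {q : ℕ}
  {R : Ω → Matrix (Fin q) V ℝ}

/-- The pairs of standardized coordinates of a Gaussian projection along two directions. -/
noncomputable def projPair {V Ω : Type*} [Fintype V] {q : ℕ} (R : Ω → Matrix (Fin q) V ℝ)
    (x y : V → ℝ) (i : Fin q) (ω : Ω) : ℝ × ℝ :=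
  (x ⬝ᵥ fun j => Real.sqrt q * R ω i j, y ⬝ᵥ fun j => Real.sqrt q * R ω i j)

lemma IsGaussianProjection.hasLaw_scaled (hR : IsGaussianProjection q R μ) (p : Fin q × V) :
    HasLaw (fun ω => Real.sqrt q * R ω p.1 p.2) (gaussianReal 0 1) μ := by
  have hq : (q : ℝ) ≠ 0 := by
    have := p.1.pos
    positivity
  convert gaussianReal_const_mul (hR.law p.1 p.2) (Real.sqrt q) using 2
  · simp
  · ext
    simp [hq]

lemma IsGaussianProjection.iIndepFun_scaled (hR : IsGaussianProjection q R μ) :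
    iIndepFun (fun (p : Fin q × V) ω => Real.sqrt q * R ω p.1 p.2) μ :=
  hR.indep.comp (fun _ t => Real.sqrt q * t) fun _ => by fun_prop

lemma IsGaussianProjection.hasLaw_projPair [Fintype V] (hR : IsGaussianProjection q R μ)
    {x y : V → ℝ} {ρ : ℝ} (hρ : ρ ^ 2 ≤ 1) (hx : x ⬝ᵥ x = 1) (hy : y ⬝ᵥ y = 1) (hxy : x ⬝ᵥ y = ρ)
    (i : Fin q) :
    HasLaw (projPair R x y i) (binormal ρ) μ :=
  hasLaw_binormal (g := fun j ω => Real.sqrt q * R ω i j) (fun j => hR.hasLaw_scaled (i, j))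
    (hR.iIndepFun_scaled.precomp (g := fun j : V => (i, j)) fun _ _ h => (Prod.mk.inj h).2)
    hρ hx hy hxy

lemma IsGaussianProjection.iIndepFun_projPair [Fintype V] (hR : IsGaussianProjection q R μ)
    (x y : V → ℝ) :
    iIndepFun (projPair R x y) μ :=
  (iIndepFun_rows hR.hasLaw_scaled hR.iIndepFun_scaled).comp
    (fun _ r => (x ⬝ᵥ r, y ⬝ᵥ r)) fun _ => by
      simp only [dotProduct]
      fun_prop

lemma cosSim_smul_smul {ι : Type*} [Fintype ι] {a b : ℝ} (ha : 0 < a) (hb : 0 < b) (x y : ι → ℝ) :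
    cosSim (a • x) (b • y) = cosSim x y := by
  unfold cosSim
  rw [WithLp.toLp_smul, WithLp.toLp_smul, norm_smul, norm_smul, Real.norm_of_nonneg ha.le,
    Real.norm_of_nonneg hb.le, smul_dotProduct, dotProduct_smul, smul_eq_mul, smul_eq_mul,
    ← mul_assoc, mul_mul_mul_comm, mul_div_mul_left _ _ (by positivity)]

lemma cosSim_mul_transpose_eq {U V Ω : Type*} [Fintype V] {q : ℕ} (P : Matrix U V ℝ)
    (M : Ω → Matrix (Fin q) V ℝ) {u v : U} {a b : ℝ} (ha : 0 < a) (hb : 0 < b) {x y : V → ℝ}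
    (hx : P u = a • x) (hy : P v = b • y)
    (ω : Ω) :
    cosSim ((P * (M ω)ᵀ) u) ((P * (M ω)ᵀ) v) = pairCos fun i => projPair M x y i ω := by
  rcases Nat.eq_zero_or_pos q with rfl | hq
  · exact congrArg₂ cosSim (Subsingleton.elim _ _) (Subsingleton.elim _ _)
  have hs : (0 : ℝ) < Real.sqrt q := Real.sqrt_pos.2 (by positivity)
  have key : ∀ {u : U} {a : ℝ} {x : V → ℝ}, P u = a • x → (P * (M ω)ᵀ) u =
      (a / Real.sqrt q) • fun i => x ⬝ᵥ fun j => Real.sqrt q * M ω i j := by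
    intro u a x h
    ext i
    have h' : ∀ j, P u j = a * x j := fun j => congrFun h j
    simp only [Matrix.mul_apply, Matrix.transpose_apply, h', Pi.smul_apply, smul_eq_mul,
      dotProduct, Finset.mul_sum]
    refine Finset.sum_congr rfl fun j _ => ?_
    field_simp
  rw [key hx, key hy, cosSim_smul_smul (by positivity) (by positivity)]
  rfl

end Projection

/-! ### Connectivity -/

section Connectivity

variable {V : Type*} [Fintype V] {A : Matrix V V ℕ}

lemma conn_self_pos (hdeg : ∀ u, 0 < deg A u) (u : V) : 0 < conn A u u := by
  obtain ⟨w, -, hw⟩ := Finset.exists_ne_zero_of_sum_ne_zero (hdeg u).ne'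
  exact lt_of_lt_of_le (Nat.mul_pos (Nat.pos_of_ne_zero hw) (Nat.pos_of_ne_zero hw))
    (Finset.single_le_sum (f := fun w => A u w * A u w) (fun _ _ => Nat.zero_le _)
      (Finset.mem_univ w))

/-- The row of `u` in the adjacency matrix, scaled to unit length. -/
noncomputable def unitRow (A : Matrix V V ℕ) (u : V) : V → ℝ :=
  (Real.sqrt (conn A u u))⁻¹ • adjMat A u

lemma adjMat_dotProduct (A : Matrix V V ℕ) (u v : V) : adjMat A u ⬝ᵥ adjMat A v = conn A u v := by
  simp [adjMat, conn, dotProduct]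

lemma unitRow_dotProduct (A : Matrix V V ℕ) (u v : V) :
    unitRow A u ⬝ᵥ unitRow A v = connCos A u v := by
  rw [unitRow, unitRow, smul_dotProduct, dotProduct_smul, adjMat_dotProduct, connCos,
    Real.sqrt_mul (Nat.cast_nonneg _), smul_eq_mul, smul_eq_mul]
  field_simp

lemma connCos_self (hdeg : ∀ u, 0 < deg A u) (u : V) : connCos A u u = 1 := by
  have : (0 : ℝ) < conn A u u := by exact_mod_cast conn_self_pos hdeg u
  rw [connCos, Real.sqrt_mul_self this.le, div_self this.ne']

lemma connDefect_eq (A : Matrix V V ℕ) (u v : V) : connDefect A u v = 1 - connCos A u v ^ 2 := by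
  rw [connDefect, connCos, div_pow, Real.sq_sqrt (by positivity)]

lemma connCos_sq_le_one (A : Matrix V V ℕ) (u v : V) : connCos A u v ^ 2 ≤ 1 := by
  rw [connCos, div_pow, Real.sq_sqrt (by positivity), ← adjMat_dotProduct, ← adjMat_dotProduct,
    ← adjMat_dotProduct]
  refine div_le_one_of_le₀ ?_ ?_
  · simpa [dotProduct, sq] using
      Finset.sum_mul_sq_le_sq_mul_sq Finset.univ (adjMat A u) (adjMat A v)
  · simp only [dotProduct]
    exact mul_nonneg (Finset.sum_nonneg fun _ _ => mul_self_nonneg _)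
      (Finset.sum_nonneg fun _ _ => mul_self_nonneg _)

lemma connCos_nonneg (A : Matrix V V ℕ) (u v : V) : 0 ≤ connCos A u v := by
  unfold connCos
  positivity

lemma connCos_comm (A : Matrix V V ℕ) (u v : V) : connCos A u v = connCos A v u := by
  rw [← unitRow_dotProduct, dotProduct_comm, unitRow_dotProduct]

lemma exists_row_eq_smul_unitRow (hdeg : ∀ u, 0 < deg A u) {P : Matrix V V ℝ}
    (hP : P = adjMat A ∨ P = transMat A) (u : V) : ∃ a : ℝ, 0 < a ∧ P u = a • unitRow A u := by
  have hc : (0 : ℝ) < Real.sqrt (conn A u u) :=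
    Real.sqrt_pos.2 (by exact_mod_cast conn_self_pos hdeg u)
  have hd : (0 : ℝ) < deg A u := by exact_mod_cast hdeg u
  rcases hP with rfl | rfl
  · refine ⟨Real.sqrt (conn A u u), hc, ?_⟩
    rw [unitRow, smul_smul, mul_inv_cancel₀ hc.ne', one_smul]
  · refine ⟨Real.sqrt (conn A u u) / deg A u, by positivity, ?_⟩
    rw [unitRow, smul_smul]
    ext w
    simp only [transMat, Matrix.of_apply, Pi.smul_apply, smul_eq_mul, adjMat, Matrix.map_apply]
    field_simp

end Connectivity

/-! ### The finite-sample bound -/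

lemma hasLaw_fst_binormal (ρ : ℝ) : HasLaw Prod.fst (gaussianReal 0 1) (binormal ρ) where
  map_eq := by
    rw [binormal, Measure.map_map measurable_fst (measurable_correlate ρ)]
    exact measurePreserving_fst.map_eq

lemma hasLaw_snd_binormal {ρ : ℝ} (hρ : ρ ^ 2 ≤ 1) :
    HasLaw Prod.snd (gaussianReal 0 1) (binormal ρ) where
  map_eq := by
    rw [binormal, Measure.map_map measurable_snd (measurable_correlate ρ)]
    have := (hasLaw_add_mul_gaussianReal_prod ρ (Real.sqrt (1 - ρ ^ 2))).map_eq
    rw [Real.sq_sqrt (by linarith), add_sub_cancel, Real.toNNReal_one] at this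
    exact this

lemma ae_ne_zero_of_hasLaw_gaussianReal {Ω : Type*} [MeasurableSpace Ω] {μ : Measure Ω} {X : Ω → ℝ}
    (hX : HasLaw X (gaussianReal 0 1) μ) : ∀ᵐ ω ∂μ, X ω ≠ 0 := by
  have := nullSingletonClass_gaussianReal (μ := 0) (v := 1) one_ne_zero
  refine (hX.ae_iff (p := fun x => x ≠ 0) ?_).2 ?_
  · exact (measurableSet_singleton (0 : ℝ)).compl.mem
  · exact measure_eq_zero_iff_ae_notMem.1 (measure_singleton (0 : ℝ))

lemma ae_binormal_one : ∀ᵐ z ∂(binormal 1), z.1 = z.2 := by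
  rw [binormal, ae_map_iff (measurable_correlate 1).aemeasurable
    (measurableSet_eq_fun measurable_fst measurable_snd)]
  simp

section Sample

variable {Ω : Type*} [MeasurableSpace Ω] {μ : Measure Ω} {q : ℕ} {Z : Fin q → Ω → ℝ × ℝ} {ρ : ℝ}

lemma ae_pairCos_eq_one (hq : 0 < q) (hZ : ∀ i, HasLaw (Z i) (binormal 1) μ) :
    ∀ᵐ ω ∂μ, pairCos (fun i => Z i ω) = 1 := by
  have h1 : ∀ᵐ ω ∂μ, ∀ i, (Z i ω).1 = (Z i ω).2 := ae_all_iff.2 fun i =>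
    ((hZ i).ae_iff (p := fun z => z.1 = z.2)
      (measurableSet_eq_fun measurable_fst measurable_snd).mem).2 ae_binormal_one
  have h2 := ae_ne_zero_of_hasLaw_gaussianReal ((hasLaw_fst_binormal 1).fun_comp (hZ ⟨0, hq⟩))
  filter_upwards [h1, h2] with ω h1 h2
  have h3 : 0 < ∑ i, (Z i ω).2 ^ 2 := by
    refine Finset.sum_pos' (fun i _ => sq_nonneg _) ⟨⟨0, hq⟩, Finset.mem_univ _, ?_⟩
    rw [← h1]
    positivity
  rw [pairCos_eq]
  simp only [h1]
  rw [Real.mul_self_sqrt h3.le, div_eq_one_iff_eq h3.ne']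
  exact Finset.sum_congr rfl fun i _ => (sq _).symm

end Sample

section Graph

variable {V : Type*} [Fintype V] {A : Matrix V V ℕ} {P : Matrix V V ℝ} {Ω : Type*}
  [MeasurableSpace Ω] {μ : Measure Ω} {q : ℕ} {R : Ω → Matrix (Fin q) V ℝ}

lemma exists_pairs (hdeg : ∀ u, 0 < deg A u) (hP : P = adjMat A ∨ P = transMat A)
    (hR : IsGaussianProjection q R μ) (u v : V) :
    ∃ Z : Fin q → Ω → ℝ × ℝ, (∀ i, HasLaw (Z i) (binormal (connCos A u v)) μ) ∧ iIndepFun Z μ ∧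
      ∀ ω, cosSim ((P * (R ω)ᵀ) u) ((P * (R ω)ᵀ) v) = pairCos fun i => Z i ω := by
  obtain ⟨a, ha, hu⟩ := exists_row_eq_smul_unitRow hdeg hP u
  obtain ⟨b, hb, hv⟩ := exists_row_eq_smul_unitRow hdeg hP v
  refine ⟨projPair R (unitRow A u) (unitRow A v), fun i => ?_, hR.iIndepFun_projPair _ _,
    fun ω => cosSim_mul_transpose_eq P R ha hb hu hv ω⟩
  refine hR.hasLaw_projPair (connCos_sq_le_one A u v) ?_ ?_ (unitRow_dotProduct A u v) i
  all_goals rw [unitRow_dotProduct, connCos_self hdeg]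

lemma ae_cosSim_eq_one (hdeg : ∀ u, 0 < deg A u) (hP : P = adjMat A ∨ P = transMat A)
    (hR : IsGaussianProjection q R μ) (hq : 0 < q) {u v : V} (huv : connCos A u v = 1) :
    ∀ᵐ ω ∂μ, cosSim ((P * (R ω)ᵀ) u) ((P * (R ω)ᵀ) v) = 1 := by
  obtain ⟨Z, hZ, -, hcos⟩ := exists_pairs hdeg hP hR u v
  rw [huv] at hZ
  simpa only [hcos] using ae_pairCos_eq_one hq hZ

lemma measure_cosSim_deviation_le [IsProbabilityMeasure μ] (hdeg : ∀ u, 0 < deg A u)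
    (hP : P = adjMat A ∨ P = transMat A) (hR : IsGaussianProjection q R μ) (hq : 0 < q) (u v : V)
    {ε : ℝ} (hε : 0 < ε) (hε' : ε ≤ 0.05) :
    μ {ω | ε * connDefect A u v <
        |cosSim ((P * (R ω)ᵀ) u) ((P * (R ω)ᵀ) v) - connCos A u v|} ≤
      ENNReal.ofReal (4 * (Real.sqrt (1 + tailRate ε))⁻¹ ^ q) := by
  rw [connDefect_eq]
  rcases (connCos_sq_le_one A u v).lt_or_eq with h | h
  · obtain ⟨Z, hZ, hind, hcos⟩ := exists_pairs hdeg hP hR u v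
    simp only [hcos]
    exact measure_pairCos_deviation_le h hZ hind hε hε'
  · have h1 : connCos A u v = 1 :=
      (pow_eq_one_iff_of_nonneg (connCos_nonneg A u v) two_ne_zero).1 h
    refine le_of_eq_of_le ?_ zero_le
    refine measure_eq_zero_iff_ae_notMem.2 ?_
    filter_upwards [ae_cosSim_eq_one hdeg hP hR hq h1] with ω hω
    simp [hω, h1]

lemma cosSim_comm {ι : Type*} [Fintype ι] (x y : ι → ℝ) : cosSim x y = cosSim y x := by
  rw [cosSim, cosSim, dotProduct_comm, mul_comm ‖_‖]

/-- The event that the cosine of a pair of nodes is not approximated up to `ε`. -/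
def deviationEvent (A : Matrix V V ℕ) (P : Matrix V V ℝ) (R : Ω → Matrix (Fin q) V ℝ) (ε : ℝ) :
    Sym2 V → Set Ω :=
  Sym2.lift ⟨fun u v => {ω | ε * connDefect A u v <
    |cosSim ((P * (R ω)ᵀ) u) ((P * (R ω)ᵀ) v) - connCos A u v|}, fun u v => by
      simp only [connDefect_eq, connCos_comm A u v, cosSim_comm ((P * (R _)ᵀ) u)]⟩

lemma sample_size_bound {n q : ℕ} {ε δ : ℝ} (hε : 0 < ε) (hδ : 0 < δ)
    (h : 2 * Real.log (2 * (n : ℝ) * ((n : ℝ) - 1) * (1 + ε ^ 2 / 4) / δ) /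
      Real.log (1 + tailRate ε) ≤ q) :
    (n.choose 2 : ℝ) * (4 * (Real.sqrt (1 + tailRate ε))⁻¹ ^ q) ≤ δ := by
  have hr := tailRate_pos hε
  have hK : 0 < Real.log (1 + tailRate ε) := Real.log_pos (by linarith)
  rw [Nat.cast_choose_two]
  rcases Nat.lt_or_ge n 2 with hn | hn
  -- No pairs, so the left side vanishes, whatever the junk value `log 0 = 0` makes of the
  -- hypothesis.
  · have : (n : ℝ) * ((n : ℝ) - 1) = 0 := by interval_cases n <;> simp
    rw [this]
    simpa using hδ.le
  have hn' : (2 : ℝ) ≤ n := by exact_mod_cast hn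
  have hN : 0 < (n : ℝ) * ((n : ℝ) - 1) := mul_pos (by linarith) (by linarith)
  set L := 2 * (n : ℝ) * ((n : ℝ) - 1) * (1 + ε ^ 2 / 4) / δ with hL
  have hL0 : 0 < L := by
    rw [hL, mul_assoc 2]
    positivity
  have hpow : L ≤ Real.sqrt (1 + tailRate ε) ^ q := by
    rw [← Real.log_le_log_iff hL0 (by positivity), Real.log_pow, Real.log_sqrt (by positivity)]
    rw [div_le_iff₀ hK] at h
    linarith
  have hinv : (Real.sqrt (1 + tailRate ε))⁻¹ ^ q ≤ L⁻¹ := by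
    rw [inv_pow]
    gcongr
  calc (n : ℝ) * ((n : ℝ) - 1) / 2 * (4 * (Real.sqrt (1 + tailRate ε))⁻¹ ^ q)
      ≤ (n : ℝ) * ((n : ℝ) - 1) / 2 * (4 * L⁻¹) := by gcongr
    _ = δ / (1 + ε ^ 2 / 4) := by
      have h1 : (n : ℝ) ≠ 0 := by linarith
      have h2 : (n : ℝ) - 1 ≠ 0 := by linarith
      rw [hL]
      field_simp
      ring
    _ ≤ δ := div_le_self hδ.le (by nlinarith)

lemma finite_sample_bound [IsProbabilityMeasure μ] (hdeg : ∀ u, 0 < deg A u)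
    (hP : P = adjMat A ∨ P = transMat A) (hR : IsGaussianProjection q R μ) (hq : 0 < q)
    {ε δ : ℝ} (hε : 0 < ε) (hε' : ε ≤ 0.05) (hδ : 0 < δ)
    (h : 2 * Real.log (2 * (Fintype.card V : ℝ) * ((Fintype.card V : ℝ) - 1) *
      (1 + ε ^ 2 / 4) / δ) / Real.log (1 + tailRate ε) ≤ q) :
    ENNReal.ofReal (1 - δ) ≤ μ {ω | ∀ u v : V,
      |cosSim ((P * (R ω)ᵀ) u) ((P * (R ω)ᵀ) v) - connCos A u v| ≤ ε * connDefect A u v} := by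
  classical
  set S := {ω | ∀ u v : V,
    |cosSim ((P * (R ω)ᵀ) u) ((P * (R ω)ᵀ) v) - connCos A u v| ≤ ε * connDefect A u v}
  have hdiag : ∀ᵐ ω ∂μ, ∀ u : V, cosSim ((P * (R ω)ᵀ) u) ((P * (R ω)ᵀ) u) = 1 :=
    ae_all_iff.2 fun u => ae_cosSim_eq_one hdeg hP hR hq (connCos_self hdeg u)
  have hcompl : μ Sᶜ ≤ ENNReal.ofReal δ := by
    -- Indexing by unordered pairs yields `n (n - 1) / 2` events of probability at most `4 x`, hence
    -- the factor `2 n (n - 1)` in the sample size. The diagonal is only almost surely exact, so the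
    -- inclusion holds almost everywhere.
    calc μ Sᶜ ≤ μ (⋃ a : {a : Sym2 V // ¬ a.IsDiag}, deviationEvent A P R ε a) := by
          refine measure_mono_ae ?_
          filter_upwards [hdiag] with ω hω hωS
          by_contra hcon
          refine hωS fun u v => ?_
          rcases eq_or_ne u v with rfl | huv
          · simp [hω, connDefect_eq, connCos_self hdeg]
          · by_contra! hlt
            exact hcon (Set.mem_iUnion.2 ⟨⟨s(u, v), by simpa using huv⟩, hlt⟩)
      _ ≤ ∑ a : {a : Sym2 V // ¬ a.IsDiag}, μ (deviationEvent A P R ε a) :=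
          measure_iUnion_fintype_le _ _
      _ ≤ ∑ _a : {a : Sym2 V // ¬ a.IsDiag},
            ENNReal.ofReal (4 * (Real.sqrt (1 + tailRate ε))⁻¹ ^ q) := by
          refine Finset.sum_le_sum fun a _ => ?_
          obtain ⟨a, -⟩ := a
          induction a with
          | _ u v => exact measure_cosSim_deviation_le hdeg hP hR hq u v hε hε'
      _ ≤ ENNReal.ofReal δ := by
          rw [Finset.sum_const, Finset.card_univ, Sym2.card_subtype_not_diag, nsmul_eq_mul,
            ← ENNReal.ofReal_natCast, ← ENNReal.ofReal_mul (by positivity)]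
          exact ENNReal.ofReal_le_ofReal (sample_size_bound hε hδ h)
  rw [ENNReal.ofReal_sub _ hδ.le, ENNReal.ofReal_one, tsub_le_iff_right]
  -- Subadditivity avoids any measurability question for `S`.
  calc (1 : ENNReal) = μ (S ∪ Sᶜ) := by rw [Set.union_compl_self, measure_univ]
    _ ≤ μ S + μ Sᶜ := measure_union_le _ _
    _ ≤ μ S + ENNReal.ofReal δ := by gcongr

end Graph

/-! ### Moments of normal pairs -/

lemma integrable_pow_gaussianReal (k : ℕ) : Integrable (fun x => x ^ k) (gaussianReal 0 1) := by
  have := integrable_pow_of_mem_interior_integrableExpSet (X := id) (μ := gaussianReal 0 1)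
    (by simp [integrableExpSet_id_gaussianReal]) k
  simpa using this

lemma integral_sq_gaussianReal : ∫ x, x ^ 2 ∂(gaussianReal 0 1) = 1 := by
  have h := variance_eq_sub (memLp_id_gaussianReal (μ := 0) (v := 1) 2)
  simpa using h.symm

lemma integral_pow_four_gaussianReal : ∫ x, x ^ 4 ∂(gaussianReal 0 1) = 3 := by
  have h := iteratedDeriv_mgf_zero (X := id) (μ := gaussianReal 0 1)
    (by simp [integrableExpSet_id_gaussianReal]) 4
  have h' : ∫ x, x ^ 4 ∂(gaussianReal 0 1) =
      iteratedDeriv 4 (mgf id (gaussianReal 0 1)) 0 := by rw [h]; rfl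
  rw [h', mgf_id_gaussianReal]
  have hE : ∀ t : ℝ, HasDerivAt (fun t : ℝ => Real.exp (t ^ 2 / 2))
      (t * Real.exp (t ^ 2 / 2)) t := by
    intro t
    have := ((hasDerivAt_pow 2 t).div_const 2).exp
    convert this using 1
    norm_num
    ring
  -- Derivatives of the moment generating function `exp (t² / 2)` stay of the form `p t * exp (t² /
  -- 2)`, with `p` replaced by `p' + t p`; the fourth one is `3` at `0`.
  have hstep : ∀ p p' : ℝ → ℝ, (∀ t, HasDerivAt p (p' t) t) →
      deriv (fun t => p t * Real.exp (t ^ 2 / 2)) =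
        fun t => (p' t + t * p t) * Real.exp (t ^ 2 / 2) := by
    intro p p' hp
    funext t
    exact ((hp t).mul (hE t)).deriv.trans (by ring)
  have e0 : (fun t : ℝ => Real.exp (0 * t + ((1 : ℝ≥0) : ℝ) * t ^ 2 / 2)) =
      fun t => Real.exp (t ^ 2 / 2) := by
    funext t
    simp
  have e1 : deriv (fun t : ℝ => Real.exp (t ^ 2 / 2)) = fun t => t * Real.exp (t ^ 2 / 2) :=
    funext fun t => (hE t).deriv
  have h2 := hstep (fun t => t) (fun _ => 1) fun t => hasDerivAt_id' t
  have h3 := hstep (fun t => 1 + t * t) (fun t => 2 * t) fun t => by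
    exact (((hasDerivAt_id' t).mul (hasDerivAt_id' t)).const_add 1).congr_deriv (by ring)
  have h4 := hstep (fun t => 2 * t + t * (1 + t * t)) (fun t => 3 + 3 * t ^ 2) fun t => by
    exact (((hasDerivAt_id' t).const_mul 2).add ((hasDerivAt_id' t).mul
      (((hasDerivAt_id' t).mul (hasDerivAt_id' t)).const_add 1))).congr_deriv (by simp; ring)
  rw [e0, iteratedDeriv_eq_iterate]
  simp only [Function.iterate_succ, Function.iterate_zero, Function.comp, id]
  rw [e1, h2, h3, h4]
  simp

lemma integrable_pow_mul_pow_gaussianReal_prod (i j : ℕ) :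
    Integrable (fun p : ℝ × ℝ => p.1 ^ i * p.2 ^ j)
      ((gaussianReal 0 1).prod (gaussianReal 0 1)) :=
  (integrable_pow_gaussianReal i).mul_prod (integrable_pow_gaussianReal j)

lemma integral_pow_mul_pow_gaussianReal_prod (i j : ℕ) :
    ∫ p : ℝ × ℝ, p.1 ^ i * p.2 ^ j ∂((gaussianReal 0 1).prod (gaussianReal 0 1)) =
      (∫ x, x ^ i ∂(gaussianReal 0 1)) * ∫ x, x ^ j ∂(gaussianReal 0 1) :=
  integral_prod_mul (fun x : ℝ => x ^ i) fun x => x ^ j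

lemma integrable_quadForm_sq_gaussianReal_prod (α β γ : ℝ) :
    Integrable (fun p => quadForm α β γ p ^ 2) ((gaussianReal 0 1).prod (gaussianReal 0 1)) ∧
      ∫ p, quadForm α β γ p ^ 2 ∂((gaussianReal 0 1).prod (gaussianReal 0 1)) =
        3 * α ^ 2 + 2 * α * γ + 3 * γ ^ 2 + β ^ 2 := by
  have hI := fun (c : ℝ) (i j : ℕ) => (integrable_pow_mul_pow_gaussianReal_prod i j).const_mul c
  have hJ := fun (c : ℝ) (i j : ℕ) =>
    integral_const_mul (μ := (gaussianReal 0 1).prod (gaussianReal 0 1)) c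
      fun p : ℝ × ℝ => p.1 ^ i * p.2 ^ j
  have e : (fun p => quadForm α β γ p ^ 2) = fun p : ℝ × ℝ =>
      α ^ 2 * (p.1 ^ 4 * p.2 ^ 0) + (2 * α * γ + β ^ 2) * (p.1 ^ 2 * p.2 ^ 2) +
        γ ^ 2 * (p.1 ^ 0 * p.2 ^ 4) + 2 * α * β * (p.1 ^ 3 * p.2 ^ 1) +
        2 * β * γ * (p.1 ^ 1 * p.2 ^ 3) := by
    funext p
    simp only [quadForm]
    ring
  have h1 := (hI (α ^ 2) 4 0).fun_add (hI (2 * α * γ + β ^ 2) 2 2)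
  have h2 := h1.fun_add (hI (γ ^ 2) 0 4)
  have h3 := h2.fun_add (hI (2 * α * β) 3 1)
  rw [e]
  refine ⟨h3.fun_add (hI (2 * β * γ) 1 3), ?_⟩
  rw [integral_add h3 (hI _ 1 3), integral_add h2 (hI _ 3 1), integral_add h1 (hI _ 0 4),
    integral_add (hI _ 4 0) (hI _ 2 2)]
  simp only [hJ, integral_pow_mul_pow_gaussianReal_prod]
  simp only [integral_sq_gaussianReal,
    integral_pow_four_gaussianReal, pow_one, integral_id_gaussianReal, pow_zero, integral_const,
    probReal_univ, smul_eq_mul]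
  ring

lemma integral_quadForm_gaussianReal_prod (α β γ : ℝ) :
    ∫ p, quadForm α β γ p ∂((gaussianReal 0 1).prod (gaussianReal 0 1)) = α + γ := by
  have hI := fun (c : ℝ) (i j : ℕ) => (integrable_pow_mul_pow_gaussianReal_prod i j).const_mul c
  have hJ := fun (c : ℝ) (i j : ℕ) =>
    integral_const_mul (μ := (gaussianReal 0 1).prod (gaussianReal 0 1)) c
      fun p : ℝ × ℝ => p.1 ^ i * p.2 ^ j
  have e : (quadForm α β γ) = fun p : ℝ × ℝ =>
      α * (p.1 ^ 2 * p.2 ^ 0) + β * (p.1 ^ 1 * p.2 ^ 1) + γ * (p.1 ^ 0 * p.2 ^ 2) := by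
    funext p
    simp only [quadForm]
    ring
  have h1 := (hI α 2 0).fun_add (hI β 1 1)
  rw [e, integral_add h1 (hI _ 0 2), integral_add (hI _ 2 0) (hI _ 1 1)]
  simp only [hJ, integral_pow_mul_pow_gaussianReal_prod]
  simp only [integral_sq_gaussianReal,
    pow_one, integral_id_gaussianReal, pow_zero, integral_const, probReal_univ, smul_eq_mul]
  ring

lemma quadForm_correlate {ρ : ℝ} (hρ : ρ ^ 2 ≤ 1) (α β γ : ℝ) (p : ℝ × ℝ) :
    quadForm α β γ (p.1, ρ * p.1 + Real.sqrt (1 - ρ ^ 2) * p.2) =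
      quadForm (α + β * ρ + γ * ρ ^ 2) ((β + 2 * γ * ρ) * Real.sqrt (1 - ρ ^ 2))
        (γ * (1 - ρ ^ 2)) p := by
  have hs : Real.sqrt (1 - ρ ^ 2) ^ 2 = 1 - ρ ^ 2 := Real.sq_sqrt (by linarith)
  simp only [quadForm]
  linear_combination (γ * p.2 ^ 2) * hs

lemma memLp_quadForm_binormal {ρ : ℝ} (hρ : ρ ^ 2 ≤ 1) (α β γ : ℝ) :
    MemLp (quadForm α β γ) 2 (binormal ρ) := by
  rw [memLp_two_iff_integrable_sq (by fun_prop), binormal,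
    integrable_map_measure (by fun_prop) (measurable_correlate ρ).aemeasurable]
  simp only [Function.comp_def, quadForm_correlate hρ]
  exact (integrable_quadForm_sq_gaussianReal_prod _ _ _).1

lemma integral_quadForm_binormal {ρ : ℝ} (hρ : ρ ^ 2 ≤ 1) (α β γ : ℝ) :
    ∫ z, quadForm α β γ z ∂(binormal ρ) = α + β * ρ + γ := by
  rw [binormal, integral_map (measurable_correlate ρ).aemeasurable (by fun_prop)]
  simp only [quadForm_correlate hρ]
  rw [integral_quadForm_gaussianReal_prod]
  ring

/-- In independent coordinates the form has square coefficients `± ρ (1 - ρ²) / 2` and cross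
coefficient `(1 - ρ²)^(3/2)`; its second moment is `ρ² (1 - ρ²)² + (1 - ρ²)³`. -/
lemma variance_quadForm_binormal {ρ : ℝ} (hρ : ρ ^ 2 ≤ 1) :
    Var[quadForm (-(ρ / 2)) 1 (-(ρ / 2)); binormal ρ] = (1 - ρ ^ 2) ^ 2 := by
  have hs : Real.sqrt (1 - ρ ^ 2) ^ 2 = 1 - ρ ^ 2 := Real.sq_sqrt (by linarith)
  rw [variance_of_integral_eq_zero (by fun_prop) (by rw [integral_quadForm_binormal hρ]; ring),
    binormal, integral_map (measurable_correlate ρ).aemeasurable (by fun_prop)]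
  simp only [quadForm_correlate hρ]
  rw [(integrable_quadForm_sq_gaussianReal_prod _ _ _).2, mul_pow _ (Real.sqrt _), hs]
  ring

/-! ### Asymptotic normality of the cosine -/

/-- Convergence in distribution only depends on the laws. -/
lemma tendstoInDistribution_of_map_eq {ι E Ω₁ Ω₂ : Type*} {Ω Ω' : ι → Type*}
    [TopologicalSpace E] [MeasurableSpace E] [OpensMeasurableSpace E]
    [∀ i, MeasurableSpace (Ω i)] [∀ i, MeasurableSpace (Ω' i)] [MeasurableSpace Ω₁]
    [MeasurableSpace Ω₂] {μ : ∀ i, Measure (Ω i)} {μ' : ∀ i, Measure (Ω' i)} {ν : Measure Ω₁}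
    {ν' : Measure Ω₂} [∀ i, IsProbabilityMeasure (μ i)] [∀ i, IsProbabilityMeasure (μ' i)]
    [IsProbabilityMeasure ν] [IsProbabilityMeasure ν'] {l : Filter ι} {X : ∀ i, Ω i → E}
    {Y : ∀ i, Ω' i → E} {Z : Ω₁ → E} {Z' : Ω₂ → E} (h : TendstoInDistribution X l Z μ ν)
    (hY : ∀ i, AEMeasurable (Y i) (μ' i)) (hZ' : AEMeasurable Z' ν')
    (hXY : ∀ i, (μ' i).map (Y i) = (μ i).map (X i)) (hZ : ν'.map Z' = ν.map Z) :
    TendstoInDistribution Y l Z' μ' ν' where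
  forall_aemeasurable := hY
  aemeasurable_limit := hZ'
  tendsto := by
    have h' := h.tendsto
    simp only [hXY, hZ]
    exact h'

section Sequence

variable {Ω : Type*} [MeasurableSpace Ω] {μ : Measure Ω} {Z : ℕ → Ω → ℝ × ℝ} {ρ : ℝ}

lemma identDistrib_comp {E : Type*} [MeasurableSpace E] (hZ : ∀ i, HasLaw (Z i) (binormal ρ) μ)
    {f : ℝ × ℝ → E} (hf : Measurable f) (i : ℕ) :
    IdentDistrib (fun ω => f (Z i ω)) (fun ω => f (Z 0 ω)) μ μ :=
  IdentDistrib.comp ⟨(hZ i).aemeasurable, (hZ 0).aemeasurable,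
    (hZ i).map_eq.trans (hZ 0).map_eq.symm⟩ hf

lemma tendstoInDistribution_inv_sqrt_mul_sum_quadForm [IsProbabilityMeasure μ] (hρ : ρ ^ 2 ≤ 1)
    (hZ : ∀ i, HasLaw (Z i) (binormal ρ) μ) (hind : iIndepFun Z μ) :
    TendstoInDistribution (fun (n : ℕ) ω => (Real.sqrt n)⁻¹ *
        ∑ i ∈ Finset.range n, quadForm (-(ρ / 2)) 1 (-(ρ / 2)) (Z i ω)) atTop (id : ℝ → ℝ)
      (fun _ => μ) (gaussianReal 0 (Real.toNNReal ((1 - ρ ^ 2) ^ 2))) := by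
  have hm := measurable_quadForm (-(ρ / 2)) 1 (-(ρ / 2))
  have hvar : Var[fun ω => quadForm (-(ρ / 2)) 1 (-(ρ / 2)) (Z 0 ω); μ] = (1 - ρ ^ 2) ^ 2 := by
    rw [← variance_quadForm_binormal hρ, ← (hZ 0).map_eq,
      variance_map hm.aemeasurable (hZ 0).aemeasurable]
    rfl
  have hmean : ∫ ω, quadForm (-(ρ / 2)) 1 (-(ρ / 2)) (Z 0 ω) ∂μ = 0 := by
    have := (hZ 0).integral_comp (f := quadForm (-(ρ / 2)) 1 (-(ρ / 2))) (by fun_prop)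
    rw [integral_quadForm_binormal hρ] at this
    exact this.trans (by ring)
  have hLp : MemLp (fun ω => quadForm (-(ρ / 2)) 1 (-(ρ / 2)) (Z 0 ω)) 2 μ := by
    have := memLp_quadForm_binormal hρ (-(ρ / 2)) 1 (-(ρ / 2))
    rw [← (hZ 0).map_eq] at this
    exact this.comp_of_map (hZ 0).aemeasurable
  have h := tendstoInDistribution_inv_sqrt_mul_sum_sub (P := μ)
    (X := fun i ω => quadForm (-(ρ / 2)) 1 (-(ρ / 2)) (Z i ω)) (Y := id)
    (P' := gaussianReal 0 (Real.toNNReal ((1 - ρ ^ 2) ^ 2))) (by rw [hvar]; exact HasLaw.id) hLp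
    (hind.comp (fun _ => quadForm (-(ρ / 2)) 1 (-(ρ / 2))) fun _ => hm)
    (identDistrib_comp hZ hm)
  simpa only [hmean, mul_zero, sub_zero] using h

lemma ae_tendsto_average_sq [IsProbabilityMeasure μ] (hZ : ∀ i, HasLaw (Z i) (binormal ρ) μ)
    (hind : iIndepFun Z μ) {f : ℝ × ℝ → ℝ} (hf : Measurable f)
    (hlaw : HasLaw f (gaussianReal 0 1) (binormal ρ)) :
    ∀ᵐ ω ∂μ, Tendsto (fun n : ℕ => (∑ i ∈ Finset.range n, f (Z i ω) ^ 2) / n) atTop (nhds 1) := by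
  have hlaw0 : HasLaw (fun ω => f (Z 0 ω)) (gaussianReal 0 1) μ := hlaw.fun_comp (hZ 0)
  have hint : Integrable (fun ω => f (Z 0 ω) ^ 2) μ := by
    have := integrable_pow_gaussianReal 2
    rw [← hlaw0.map_eq] at this
    exact this.comp_aemeasurable hlaw0.aemeasurable
  have hmean : ∫ ω, f (Z 0 ω) ^ 2 ∂μ = 1 :=
    (hlaw0.integral_comp (f := fun x => x ^ 2) (by fun_prop)).trans integral_sq_gaussianReal
  rw [← hmean]
  refine strong_law_ae_real (fun i ω => f (Z i ω) ^ 2) hint (fun i j hij => ?_)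
    (identDistrib_comp hZ (f := fun z => f z ^ 2) (by fun_prop))
  exact (hind.comp (fun _ z => f z ^ 2) fun _ => by fun_prop).indepFun hij

/-- The sum is centred with variance `n v`, so Chebyshev bounds the probability of exceeding `ε` by
`v / (ε √n)`. -/
lemma tendstoInMeasure_norm_gap [IsProbabilityMeasure μ] (hρ : ρ ^ 2 ≤ 1)
    (hZ : ∀ i, HasLaw (Z i) (binormal ρ) μ) (hind : iIndepFun Z μ) :
    TendstoInMeasure μ (fun (n : ℕ) ω => (∑ i ∈ Finset.range n, quadForm 1 0 (-1) (Z i ω)) ^ 2 /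
      (n * Real.sqrt n)) atTop fun _ => 0 := by
  set η : ℕ → Ω → ℝ := fun i ω => quadForm 1 0 (-1) (Z i ω) with hη
  have hm := measurable_quadForm 1 0 (-1)
  have hLp : ∀ i, MemLp (η i) 2 μ := fun i => by
    have := memLp_quadForm_binormal hρ 1 0 (-1)
    rw [← (hZ i).map_eq] at this
    exact this.comp_of_map (hZ i).aemeasurable
  have hmean : ∀ i, ∫ ω, η i ω ∂μ = 0 := fun i => by
    have := (hZ i).integral_comp (f := quadForm 1 0 (-1)) (by fun_prop)
    rw [integral_quadForm_binormal hρ] at this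
    exact this.trans (by ring)
  have hindη : iIndepFun η μ := hind.comp (fun _ => quadForm 1 0 (-1)) fun _ => hm
  set v := Var[η 0; μ] with hv
  have hvar : ∀ n : ℕ, Var[∑ i ∈ Finset.range n, η i; μ] = n * v := fun n => by
    rw [IndepFun.variance_sum (fun i _ => hLp i) fun i _ j _ hij => hindη.indepFun hij]
    rw [Finset.sum_congr rfl fun i _ => (identDistrib_comp hZ hm i).variance_eq]
    simp [hv, hη]
  have hmeanS : ∀ n : ℕ, ∫ ω, (∑ i ∈ Finset.range n, η i) ω ∂μ = 0 := fun n => by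
    simp only [Finset.sum_apply]
    rw [integral_finsetSum _ fun i _ => (hLp i).integrable (by norm_num)]
    simp [hmean]
  rw [tendstoInMeasure_iff_norm]
  intro ε hε
  have hlim : Tendsto (fun n : ℕ => ENNReal.ofReal (v / ε * (Real.sqrt n)⁻¹)) atTop (nhds 0) := by
    rw [← ENNReal.ofReal_zero]
    refine ENNReal.tendsto_ofReal ?_
    have : Tendsto (fun n : ℕ => (Real.sqrt n)⁻¹) atTop (nhds 0) :=
      (Real.tendsto_sqrt_atTop.comp tendsto_natCast_atTop_atTop).inv_tendsto_atTop
    simpa using this.const_mul (v / ε)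
  refine tendsto_of_tendsto_of_tendsto_of_le_of_le' tendsto_const_nhds hlim
    (Eventually.of_forall fun _ => zero_le) ?_
  filter_upwards [eventually_gt_atTop 0] with n hn
  have hn' : (0 : ℝ) < n := by exact_mod_cast hn
  have hs : 0 < Real.sqrt n := Real.sqrt_pos.2 hn'
  have hc : 0 < Real.sqrt (ε * (n * Real.sqrt n)) := Real.sqrt_pos.2 (by positivity)
  have hcheb := meas_ge_le_variance_div_sq (μ := μ)
    (memLp_finsetSum' (Finset.range n) fun i _ => hLp i) hc
  rw [hvar, Real.sq_sqrt (by positivity)] at hcheb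
  refine (measure_mono fun ω hω => ?_).trans (hcheb.trans_eq ?_)
  · simp only [Set.mem_ofPred_eq, sub_zero] at hω ⊢
    rw [hmeanS, sub_zero, Finset.sum_apply]
    rw [Real.norm_of_nonneg (by positivity), le_div_iff₀ (by positivity)] at hω
    rw [← Real.sqrt_sq_eq_abs]
    exact Real.sqrt_le_sqrt hω
  · congr 1
    field_simp

/-- Decomposition of the normalized error of the cosine into a normalized sum of independent
terms and a negligible quadratic error. -/
lemma sqrt_mul_cos_sub_eq {a b d N ρ : ℝ} (ha : 0 < a) (hd : 0 < d) (hN : 0 < N) :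
    N * (b / (Real.sqrt a * Real.sqrt d) - ρ) =
      N⁻¹ * (b - ρ / 2 * (a + d)) * (Real.sqrt (a / N ^ 2) * Real.sqrt (d / N ^ 2))⁻¹ +
      ρ / 2 * ((a - d) ^ 2 / (N ^ 2 * N)) *
        ((Real.sqrt (a / N ^ 2) + Real.sqrt (d / N ^ 2)) ^ 2 *
          (Real.sqrt (a / N ^ 2) * Real.sqrt (d / N ^ 2)))⁻¹ := by
  rw [Real.sqrt_div ha.le, Real.sqrt_div hd.le, Real.sqrt_sq hN.le]
  obtain ⟨A, hA, rfl⟩ : ∃ A, 0 < A ∧ a = A ^ 2 :=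
    ⟨Real.sqrt a, Real.sqrt_pos.2 ha, (Real.sq_sqrt ha.le).symm⟩
  obtain ⟨D, hD, rfl⟩ : ∃ D, 0 < D ∧ d = D ^ 2 :=
    ⟨Real.sqrt d, Real.sqrt_pos.2 hd, (Real.sq_sqrt hd.le).symm⟩
  rw [Real.sqrt_sq hA.le, Real.sqrt_sq hD.le]
  field_simp
  ring

lemma tendstoInDistribution_sqrt_mul_pairCos_sub [IsProbabilityMeasure μ] (hρ : ρ ^ 2 ≤ 1)
    (hZ : ∀ i, HasLaw (Z i) (binormal ρ) μ) (hind : iIndepFun Z μ) :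
    TendstoInDistribution (fun (n : ℕ) ω =>
        Real.sqrt n * (pairCos (fun i : Fin n => Z i ω) - ρ)) atTop (id : ℝ → ℝ)
      (fun _ => μ) (gaussianReal 0 (Real.toNNReal ((1 - ρ ^ 2) ^ 2))) := by
  set X : ℕ → Ω → ℝ := fun n ω => (Real.sqrt n)⁻¹ *
    ∑ i ∈ Finset.range n, quadForm (-(ρ / 2)) 1 (-(ρ / 2)) (Z i ω)
  set τ : ℕ → Ω → ℝ := fun n ω => (∑ i ∈ Finset.range n, quadForm 1 0 (-1) (Z i ω)) ^ 2 /
    (n * Real.sqrt n)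
  set α : ℕ → Ω → ℝ := fun n ω => Real.sqrt ((∑ i ∈ Finset.range n, (Z i ω).1 ^ 2) / n)
  set β : ℕ → Ω → ℝ := fun n ω => Real.sqrt ((∑ i ∈ Finset.range n, (Z i ω).2 ^ 2) / n)
  have hmZ : ∀ i, AEMeasurable (Z i) μ := fun i => (hZ i).aemeasurable
  have hα : ∀ n, AEMeasurable (α n) μ := fun n => by fun_prop
  have hβ : ∀ n, AEMeasurable (β n) μ := fun n => by fun_prop
  have hτ : ∀ n, AEMeasurable (τ n) μ := fun n => by
    have : ∀ i, AEMeasurable (fun ω => quadForm 1 0 (-1) (Z i ω)) μ := fun i =>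
      (measurable_quadForm 1 0 (-1)).comp_aemeasurable (hmZ i)
    fun_prop
  set Y : ℕ → Ω → ℝ × ℝ := fun n ω =>
    ((α n ω * β n ω)⁻¹, ((α n ω + β n ω) ^ 2 * (α n ω * β n ω))⁻¹)
  have hY : ∀ n, AEMeasurable (Y n) μ := fun n => by fun_prop
  have hYlim : TendstoInMeasure μ Y atTop fun _ => ((1 : ℝ), (1 / 4 : ℝ)) := by
    refine tendstoInMeasure_of_tendsto_ae (fun n => (hY n).aestronglyMeasurable) ?_
    filter_upwards [ae_tendsto_average_sq hZ hind measurable_fst (hasLaw_fst_binormal ρ),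
      ae_tendsto_average_sq hZ hind measurable_snd (hasLaw_snd_binormal hρ)] with ω h1 h2
    have h1' : Tendsto (fun n => α n ω) atTop (nhds 1) := by
      have := h1.sqrt
      rwa [Real.sqrt_one] at this
    have h2' : Tendsto (fun n => β n ω) atTop (nhds 1) := by
      have := h2.sqrt
      rwa [Real.sqrt_one] at this
    have h3 := (h1'.mul h2').inv₀ (by norm_num)
    have h4 := (((h1'.add h2').pow 2).mul (h1'.mul h2')).inv₀ (by norm_num)
    rw [show ((1 : ℝ) * 1)⁻¹ = 1 by norm_num] at h3
    rw [show (((1 : ℝ) + 1) ^ 2 * (1 * 1))⁻¹ = 1 / 4 by norm_num] at h4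
    exact h3.prodMk_nhds h4
  have hX := tendstoInDistribution_inv_sqrt_mul_sum_quadForm hρ hZ hind
  have hXτ := hX.prodMk_of_tendstoInMeasure_const X τ id (tendstoInMeasure_norm_gap hρ hZ hind) hτ
  -- Slutsky: at the limit point `((x, 0), (1, 1/4))` the function below equals `x`.
  have hlim := hXτ.continuous_comp_prodMk_of_tendstoInMeasure_const
    (g := fun p : (ℝ × ℝ) × (ℝ × ℝ) => p.1.1 * p.2.1 + ρ / 2 * p.1.2 * p.2.2) (by fun_prop)
    hYlim hY
  refine hlim.congr (fun n => ?_) (ae_of_all _ fun x => by simp)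
  rcases Nat.eq_zero_or_pos n with rfl | hn
  · simp [X, τ]
  have hpos : ∀ {f : ℝ × ℝ → ℝ}, HasLaw f (gaussianReal 0 1) (binormal ρ) →
      ∀ᵐ ω ∂μ, 0 < ∑ i ∈ Finset.range n, f (Z i ω) ^ 2 := fun {f} hf => by
    filter_upwards [ae_ne_zero_of_hasLaw_gaussianReal (hf.fun_comp (hZ 0))] with ω hω
    exact Finset.sum_pos' (fun i _ => sq_nonneg _) ⟨0, Finset.mem_range.2 hn, by positivity⟩
  filter_upwards [hpos (hasLaw_fst_binormal ρ), hpos (hasLaw_snd_binormal hρ)] with ω ha hd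
  have hN : (0 : ℝ) < Real.sqrt n := Real.sqrt_pos.2 (by exact_mod_cast hn)
  have hN2 : Real.sqrt n ^ 2 = n := Real.sq_sqrt (Nat.cast_nonneg n)
  have hdec := sqrt_mul_cos_sub_eq (b := ∑ i ∈ Finset.range n, (Z i ω).1 * (Z i ω).2) (ρ := ρ)
    ha hd hN
  rw [hN2] at hdec
  rw [pairCos_eq, ← Finset.sum_range fun i => (Z i ω).1 * (Z i ω).2,
    ← Finset.sum_range fun i => (Z i ω).1 ^ 2, ← Finset.sum_range fun i => (Z i ω).2 ^ 2, hdec]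
  have e1 : ∑ i ∈ Finset.range n, quadForm (-(ρ / 2)) 1 (-(ρ / 2)) (Z i ω) =
      ∑ i ∈ Finset.range n, (Z i ω).1 * (Z i ω).2 -
        ρ / 2 * (∑ i ∈ Finset.range n, (Z i ω).1 ^ 2 + ∑ i ∈ Finset.range n, (Z i ω).2 ^ 2) := by
    simp only [quadForm, Finset.sum_add_distrib, ← Finset.mul_sum]
    ring
  have e2 : ∑ i ∈ Finset.range n, quadForm 1 0 (-1) (Z i ω) =
      ∑ i ∈ Finset.range n, (Z i ω).1 ^ 2 - ∑ i ∈ Finset.range n, (Z i ω).2 ^ 2 := by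
    simp only [quadForm, Finset.sum_add_distrib, ← Finset.mul_sum]
    ring
  simp only [X, τ, Y, α, β, e1, e2]

end Sequence

lemma measurable_pairCos (q : ℕ) : Measurable (pairCos : (Fin q → ℝ × ℝ) → ℝ) := by
  have : (pairCos : (Fin q → ℝ × ℝ) → ℝ) = fun z => (∑ i, (z i).1 * (z i).2) /
      (Real.sqrt (∑ i, (z i).1 ^ 2) * Real.sqrt (∑ i, (z i).2 ^ 2)) := funext pairCos_eq
  rw [this]
  fun_prop

lemma isAsympNormal_cosSim {V : Type*} [Fintype V] {A : Matrix V V ℕ} (hdeg : ∀ u, 0 < deg A u)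
    {P : Matrix V V ℝ} (hP : P = adjMat A ∨ P = transMat A) {Ω : ℕ → Type*}
    [∀ q, MeasurableSpace (Ω q)] (μ : ∀ q, Measure (Ω q)) [∀ q, IsProbabilityMeasure (μ q)]
    {R : ∀ q, Ω q → Matrix (Fin q) V ℝ} (hR : ∀ q, IsGaussianProjection q (R q) (μ q)) (u v : V) :
    IsAsympNormal μ (fun q ω => cosSim ((P * (R q ω)ᵀ) u) ((P * (R q ω)ᵀ) v))
      (connCos A u v) (connDefect A u v) := by
  set ρ := connCos A u v
  have hρ : ρ ^ 2 ≤ 1 := connCos_sq_le_one A u v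
  choose Z hZ hind hcos using fun q => exists_pairs hdeg hP (hR q) u v
  -- The projections for different `q` live on unrelated spaces. Convergence in distribution sees
  -- only the laws, so they are replaced by the initial segments of one i.i.d. sequence, on which
  -- the strong law makes sense.
  set B := Measure.infinitePi fun _ : ℕ => binormal ρ
  have hWlaw : ∀ i : ℕ, HasLaw (fun ω : ℕ → ℝ × ℝ => ω i) (binormal ρ) B := fun i =>
    ⟨(measurable_pi_apply i).aemeasurable, Measure.infinitePi_map_eval _ i⟩
  have hWind : iIndepFun (fun (i : ℕ) (ω : ℕ → ℝ × ℝ) => ω i) B :=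
    iIndepFun_infinitePi (X := fun _ z => z) fun _ => measurable_id
  have hlaw : ∀ q, HasLaw (fun ω i => Z q i ω) (Measure.pi fun _ : Fin q => binormal ρ) (μ q) :=
    fun q => (hind q).hasLaw_pi (hZ q)
  have hWq : ∀ q, HasLaw (fun (ω : ℕ → ℝ × ℝ) (i : Fin q) => ω i)
      (Measure.pi fun _ : Fin q => binormal ρ) B := fun q =>
    (hWind.precomp Fin.val_injective).hasLaw_pi fun i => hWlaw i
  have hF : ∀ q : ℕ, Measurable fun z : Fin q → ℝ × ℝ => Real.sqrt q * (pairCos z - ρ) := fun q =>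
    ((measurable_pairCos q).sub_const ρ).const_mul _
  have main : TendstoInDistribution (fun (q : ℕ) (ω : Ω q) => Real.sqrt q *
      (cosSim ((P * (R q ω)ᵀ) u) ((P * (R q ω)ᵀ) v) - ρ)) atTop
      (id : ℝ → ℝ) μ (gaussianReal 0 (Real.toNNReal (connDefect A u v ^ 2))) := by
    rw [connDefect_eq]
    simp only [hcos]
    refine tendstoInDistribution_of_map_eq
      (tendstoInDistribution_sqrt_mul_pairCos_sub hρ hWlaw hWind)
      (fun q => (hF q).comp_aemeasurable (hlaw q).aemeasurable) aemeasurable_id (fun q => ?_) rfl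
    have e1 := AEMeasurable.map_map_of_aemeasurable (hF q).aemeasurable (hlaw q).aemeasurable
    have e2 := AEMeasurable.map_map_of_aemeasurable (hF q).aemeasurable (hWq q).aemeasurable
    rw [(hlaw q).map_eq] at e1
    rw [(hWq q).map_eq] at e2
    exact e1.symm.trans e2
  refine ⟨fun hσ => ?_, main⟩
  set σ := connDefect A u v
  have h := main.continuous_comp (g := fun x => x / σ) (by fun_prop)
  refine tendstoInDistribution_of_map_eq h (fun q => ?_) aemeasurable_id (fun q => ?_) ?_
  · refine (h.forall_aemeasurable q).congr (ae_of_all _ fun ω => ?_)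
    simp only [Function.comp]
    ring
  · congr 1
    funext ω
    simp only [Function.comp]
    ring
  · rw [Measure.map_id, Function.comp_id, gaussianReal_map_div_const]
    congr 1
    · simp
    · ext
      simp [max_eq_left (sq_nonneg σ), hσ]

end RPCosine

theorem mainTheorem1 {V : Type*} [Fintype V] (A : Matrix V V ℕ)
    (hdeg : ∀ u, 0 < RPCosine.deg A u)
    (P : Matrix V V ℝ) (hP : P = RPCosine.adjMat A ∨ P = RPCosine.transMat A)
    {Ω : ℕ → Type*} [∀ q, MeasurableSpace (Ω q)] (μ : ∀ q, Measure (Ω q))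
    [∀ q, IsProbabilityMeasure (μ q)]
    (R : ∀ q, Ω q → Matrix (Fin q) V ℝ)
    (hR : ∀ q, RPCosine.IsGaussianProjection q (R q) (μ q)) :
    (∀ u v : V, RPCosine.IsAsympNormal μ
      (fun q ω => RPCosine.cosSim ((P * (R q ω)ᵀ) u) ((P * (R q ω)ᵀ) v))
      (RPCosine.connCos A u v) (RPCosine.connDefect A u v)) ∧
    (∀ ε ∈ Set.Ioc (0 : ℝ) 0.05, ∀ δ ∈ Set.Ioo (0 : ℝ) 1, ∀ q : ℕ, 0 < q →
      2 * Real.log (2 * (Fintype.card V : ℝ) * ((Fintype.card V : ℝ) - 1) * (1 + ε ^ 2 / 4) / δ)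
          / Real.log (1 + ε ^ 2 / (2 * (1 + ε * Real.sqrt 2))) ≤ (q : ℝ) →
      ENNReal.ofReal (1 - δ) ≤ μ q {ω | ∀ u v : V,
        |RPCosine.cosSim ((P * (R q ω)ᵀ) u) ((P * (R q ω)ᵀ) v) - RPCosine.connCos A u v|
          ≤ ε * RPCosine.connDefect A u v}) :=
  ⟨fun u v => RPCosine.isAsympNormal_cosSim hdeg hP μ hR u v,
    fun _ hε _ hδ q hq h => RPCosine.finite_sample_bound hdeg hP (hR q) hq hε.1 hε.2 hδ.1 h⟩
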